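/- Let $q$ be an odd prime power and let $\mathbf F_q$ be the field with $q$ elements. For $\delta\in\mathbf F_q^\times$ put $\psi(\delta)=+1$ if $\delta$ is a square in $\mathbf F_q$ and $\psi(\delta)=-1$ otherwise. A symmetric $n\times n$ matrix $A$ over $\mathbf F_q$ of rank $r>0$ has (quadratic) character $+1$ if $A=M\,\mathrm{diag}(1^r,0^{n-r})\,M^T$ for some $M\in\mathbf{GL}(n,q)$, and character $-1$ if $A=M\,\mathrm{diag}(1^{r-1},z,0^{n-r})\,M^T$ for some $M\in\mathbf{GL}(n,q)$ and some non-square $z\in\mathbf F_q$; the zero matrix has character $+1$. Let $\mathrm{sym}(n,r)$ be the number of symmetric $n\times n$ matrices over $\mathbf F_q$ of rank $r$, let $\mathrm{sym}_0(n,k,r)$ be the number of those whose first $k$ diagonal entries are $0$ (no condition on the other entries), and for $\psi\in\{+1,-1\}$ let $\mathrm{sym}_0^{\psi}(n,k,r)$ be the number of the latter that have character $\psi$. Let $n,k$ be integers with $0\le k\le n$ and let $\psi\in\{+1,-1\}$. (1) If $r\ge 1$ is odd, put $t=0$ if $(-1)^{(r+1)/2}$ is a square in $\mathbf F_q$ and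 $t=1$ otherwise. Then \[ \mathrm{sym}_0^{\psi}(n+1,k+1,r+1)=\frac1q\,\mathrm{sym}_0^{\psi}(n+1,k,r+1)+(-1)^t\,\psi\left(\frac12\,\mathrm{sym}_0(n,k,r)+\mathrm{sym}_0^{\psi}(n,k,r+1)\right)\left(q^{(r+1)/2}-q^{(r-1)/2}\right). \] (2) If $r>0$ is even, put $t=0$ if $(-1)^{r/2}$ is a square in $\mathbf F_q$ and $t=1$ otherwise. Then \[ \mathrm{sym}_0^{\psi}(n+1,k+1,r+1)=\frac1q\,\mathrm{sym}_0^{\psi}(n+1,k,r+1)-\frac{(-1)^t}{2}\left(\mathrm{sym}_0^{+}(n,k,r)-\mathrm{sym}_0^{-}(n,k,r)\right)\left(q^{r/2}-q^{r/2-1}\right). \] (3) The initial values are \[ \mathrm{sym}_0^{\psi}(n+1,k+1,1)=\frac12\,\mathrm{sym}_0(n+1,k+1,1)=\frac{q-1}{2}\sum_{i=0}^{n-k-1}q^i=\frac{q^{n-k}-1}{2}, \] and, for all integers $n,s\ge 0$, \[ \mathrm{sym}_0^{+}(n,0,2s+1)=\frac12\,\mathrm{sym}(n,2s+1),\qquad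 \mathrm{sym}_0^{+}(n,0,2s)=\frac12\cdot\frac{q^s+(\psi(-1))^s}{q^s}\,\mathrm{sym}(n,2s), \] where $\psi(-1)=+1$ if $-1$ is a square in $\mathbf F_q$ and $\psi(-1)=-1$ otherwise. -/

import Mathlib

/-- The `n × n` diagonal matrix `diag(1^{r-1}, δ, 0^{n-r})`
(for `r = 0` it is the zero matrix). -/
def normalForm {F : Type*} [Field F] (n r : ℕ) (δ : F) : Matrix (Fin n) (Fin n) F :=
  Matrix.diagonal fun i : Fin n =>
    if (i : ℕ) + 1 < r then 1 else if (i : ℕ) + 1 = r then δ else 0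

/-- The symmetric matrix `A` of rank `r` has quadratic character `ε ∈ {+1, -1}`:
`A = M * diag(1^r, 0^{n-r}) * Mᵀ` with `M` invertible for `ε = 1`, and
`A = M * diag(1^{r-1}, z, 0^{n-r}) * Mᵀ` with `M` invertible and `z` a non-square for `ε = -1`.
The zero matrix has character `1` only. -/
def HasCharacter {F : Type*} [Field F] {n : ℕ} (A : Matrix (Fin n) (Fin n) F) (ε : ℤˣ) : Prop :=
  (ε = 1 ∧ ∃ M : Matrix (Fin n) (Fin n) F, IsUnit M ∧
      A = M * normalForm n A.rank (1 : F) * M.transpose) ∨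
  (ε = -1 ∧ A ≠ 0 ∧ ∃ (z : F) (M : Matrix (Fin n) (Fin n) F), ¬ IsSquare z ∧ IsUnit M ∧
      A = M * normalForm n A.rank z * M.transpose)

/-- Number of symmetric `n × n` matrices over `F` of rank `r`. -/
noncomputable def sym (F : Type*) [Field F] (n r : ℕ) : ℕ :=
  Nat.card {A : Matrix (Fin n) (Fin n) F // A.IsSymm ∧ A.rank = r}

/-- Number of symmetric `n × n` matrices over `F` of rank `r` whose first `k` diagonal entries
are zero. -/
noncomputable def symZero (F : Type*) [Field F] (n k r : ℕ) : ℕ :=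
  Nat.card {A : Matrix (Fin n) (Fin n) F //
    A.IsSymm ∧ A.rank = r ∧ ∀ i : Fin n, (i : ℕ) < k → A i i = 0}

/-- Number of symmetric `n × n` matrices over `F` of rank `r` and quadratic character `ε` whose
first `k` diagonal entries are zero. -/
noncomputable def symZeroChar (F : Type*) [Field F] (ε : ℤˣ) (n k r : ℕ) : ℕ :=
  Nat.card {A : Matrix (Fin n) (Fin n) F //
    A.IsSymm ∧ A.rank = r ∧ (∀ i : Fin n, (i : ℕ) < k → A i i = 0) ∧ HasCharacter A ε}

open Classical in
/-- `0` if `(-1) ^ m` is a square in `F`, and `1` otherwise. -/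
noncomputable def tExp (F : Type*) [Field F] (m : ℕ) : ℕ :=
  if IsSquare ((-1 : F) ^ m) then 0 else 1

/-! Fix a nontrivial additive character of the field, let `G` be the quadratic Gauss sum and `γ = G
/ q`. For a symmetric `A` of size `n`, the exponential sum of its quadratic form equals `q ^ n * γ ^
A.rank * χ(A)` with `χ(A) = ±1` the quadratic character. Since `|γ| ^ 2 = 1 / q`, the absolute value
of the sum determines the rank and then its value determines `χ` (`rank_and_quadChi_of_expSum_eq`).
Rank and character of a bordered matrix can thus be found by evaluating a sum.

Border `B` by a diagonal entry `d` and a vector `x`. If `x` is outside the range of `B`, the rank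
grows by 2 and `χ` is multiplied by `η(-1)`, whatever `d` is. If `x = B y`, completing the square
leaves the scalar `d - Q(y)`, with `Q` the form of `B`: the rank is unchanged if it vanishes, and
otherwise grows by 1 with `χ` multiplied by its `η`. Forcing `d = 0` therefore differs from
averaging over `d` only through the number of zeros of `Q` and the sum of `η(Q(y))`. The former
deviates from its mean only in even rank, the latter is nonzero only in odd rank (`card_zeros_sub`,
`sum_eta_quadVal`). This is `sum_weight_bordered_zero`.

Summing over `B` gives recursions for the number of matrices (`rankSum`) and for the sum of their
characters (`charSum`). The counts by character are `(rankSum ± charSum) / 2`, and `charSum`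
vanishes in odd rank by scaling with a non-square. With no diagonal condition, bordering with free
`d` yields, by induction on the size, the ratio of `charSum` to `rankSum` in even rank. -/

section SymmetricMatrixCounts

open Matrix Finset

/-! ### Gauss sums and one-variable quadratic exponential sums. -/

section Scalars

variable (F : Type*) [Field F] [Fintype F] [DecidableEq F]

/-- A fixed primitive additive character of a finite field. -/
noncomputable def stdChar : AddChar F ℂ := AddChar.FiniteField.primitiveChar_to_Complex F

/-- The quadratic character with complex values. -/
noncomputable def eta {F : Type*} [Field F] [Fintype F] [DecidableEq F] (a : F) : ℂ :=
  ((quadraticChar F a : ℤ) : ℂ)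

/-- The quadratic Gauss sum. -/
noncomputable def quadGauss : ℂ := ∑ a : F, eta a * stdChar F a

/-- The quadratic Gauss sum divided by the order of the field. -/
noncomputable def normGauss : ℂ := quadGauss F / Fintype.card F

variable {F}

theorem sum_stdChar_mul (a : F) :
    ∑ x : F, stdChar F (a * x) = if a = 0 then (Fintype.card F : ℂ) else 0 := by
  have := AddChar.sum_mulShift a (AddChar.FiniteField.primitiveChar_to_Complex_isPrimitive F)
  simp_rw [mul_comm a]
  simpa [stdChar] using this

theorem eta_mul (a b : F) : eta (a * b) = eta a * eta b := by
  unfold eta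
  rw [map_mul, Int.cast_mul]

@[simp] theorem eta_zero : eta (0 : F) = 0 := by simp [eta]

@[simp] theorem eta_one : eta (1 : F) = 1 := by simp [eta]

theorem eta_sq {a : F} (ha : a ≠ 0) : eta a ^ 2 = 1 := by
  have := quadraticChar_sq_one ha
  unfold eta
  exact_mod_cast this

theorem eta_ne_zero {a : F} (ha : a ≠ 0) : eta a ≠ 0 := by
  intro h
  simpa [h] using eta_sq ha

theorem eta_eq_one_or {a : F} (ha : a ≠ 0) : eta a = 1 ∨ eta a = -1 :=
  mul_self_eq_one_iff.1 (by rw [← sq, eta_sq ha])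

theorem eta_of_isSquare {a : F} (ha : a ≠ 0) (h : IsSquare a) : eta a = 1 := by
  simp [eta, (quadraticChar_one_iff_isSquare ha).2 h]

theorem eta_of_not_isSquare {a : F} (h : ¬ IsSquare a) : eta a = -1 := by
  simp [eta, quadraticChar_neg_one_iff_not_isSquare.2 h]

theorem sum_eta (hF : ringChar F ≠ 2) : ∑ a : F, eta a = 0 := by
  have := quadraticChar_sum_zero hF
  unfold eta
  exact_mod_cast this

omit [DecidableEq F] in
theorem card_complex_ne_zero : (Fintype.card F : ℂ) ≠ 0 := by
  exact_mod_cast Fintype.card_ne_zero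

theorem quadGauss_eq_gaussSum :
    quadGauss F = gaussSum ((quadraticChar F).ringHomComp (Int.castRingHom ℂ)) (stdChar F) := by
  simp [quadGauss, gaussSum, eta]

theorem quadGauss_sq (hF : ringChar F ≠ 2) :
    quadGauss F ^ 2 = eta (-1 : F) * Fintype.card F := by
  rw [quadGauss_eq_gaussSum, gaussSum_sq]
  · simp [eta]
  · exact (MulChar.ringHomComp_ne_one_iff (RingHom.injective_int _)).2 (quadraticChar_ne_one hF)
  · exact (quadraticChar_isQuadratic F).comp _
  · exact AddChar.FiniteField.primitiveChar_to_Complex_isPrimitive F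

theorem quadGauss_ne_zero (hF : ringChar F ≠ 2) : quadGauss F ≠ 0 := by
  intro h
  have := quadGauss_sq hF
  rw [h] at this
  simp [eta_ne_zero (neg_ne_zero.2 (one_ne_zero (α := F)))] at this

theorem normGauss_ne_zero (hF : ringChar F ≠ 2) : normGauss F ≠ 0 :=
  div_ne_zero (quadGauss_ne_zero hF) card_complex_ne_zero

theorem card_mul_normGauss : (Fintype.card F : ℂ) * normGauss F = quadGauss F :=
  mul_div_cancel₀ _ card_complex_ne_zero

theorem card_mul_normGauss_sq (hF : ringChar F ≠ 2) :
    (Fintype.card F : ℂ) * normGauss F ^ 2 = eta (-1 : F) := by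
  have h := card_complex_ne_zero (F := F)
  rw [normGauss, div_pow, quadGauss_sq hF]
  field_simp

/-- From `|γ| ^ 2 * q = 1` and `q > 1` it follows that `|γ| ≠ 1`. This is what lets an exponential
sum reveal the rank. -/
theorem norm_normGauss_pow_injective (hF : ringChar F ≠ 2) :
    Function.Injective fun r : ℕ => ‖normGauss F‖ ^ r := by
  have h1 : ‖normGauss F‖ ^ 2 * Fintype.card F = 1 := by
    have h := congrArg norm (card_mul_normGauss_sq hF)
    have h2 : ‖eta (-1 : F)‖ = 1 := by
      rcases eta_eq_one_or (neg_ne_zero.2 (one_ne_zero (α := F))) with h | h <;> simp [h]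
    rw [norm_mul, norm_pow, h2] at h
    simpa [mul_comm] using h
  have hq : (1 : ℝ) < Fintype.card F := by exact_mod_cast Fintype.one_lt_card
  refine pow_right_injective₀ (norm_pos_iff.2 (normGauss_ne_zero hF)) ?_
  intro h
  rw [h] at h1
  linarith

theorem sum_eta_mul_stdChar (hF : ringChar F ≠ 2) (t : F) :
    ∑ a : F, eta a * stdChar F (a * t) = eta t * quadGauss F := by
  rcases eq_or_ne t 0 with rfl | ht
  · simp [sum_eta hF]
  · rw [quadGauss, Finset.mul_sum]
    refine Fintype.sum_bijective (· * t) (mulRight_bijective₀ t ht) _ _ fun a => ?_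
    rw [eta_mul]
    linear_combination (- eta a * stdChar F (a * t)) * eta_sq ht

/-- Each `t` has `η(t) + 1` square roots, so grouping by `t = x ^ 2` leaves a Gauss sum and, for `c
≠ 0`, a vanishing complete character sum. -/
theorem sum_stdChar_mul_sq (hF : ringChar F ≠ 2) (c : F) :
    ∑ x : F, stdChar F (c * x ^ 2) =
      Fintype.card F * if c = 0 then 1 else normGauss F * eta c := by
  split_ifs with hc
  · simp [hc]
  have h1 : ∀ t : F, ((Finset.univ.filter fun x : F => x ^ 2 = t).card : ℂ) = eta t + 1 := by
    intro t
    have h := quadraticChar_card_sqrts hF t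
    have h2 : (Finset.univ.filter fun x : F => x ^ 2 = t) = {x : F | x ^ 2 = t}.toFinset := by
      ext; simp
    rw [h2, eta]
    exact_mod_cast h
  rw [← Finset.sum_fiberwise (s := Finset.univ) (g := fun x : F => x ^ 2)]
  have h3 : ∀ t : F, ∑ x ∈ Finset.univ.filter (fun x : F => x ^ 2 = t), stdChar F (c * x ^ 2)
      = (eta t + 1) * stdChar F (c * t) := by
    intro t
    rw [← h1, ← nsmul_eq_mul, ← Finset.sum_const]
    refine Finset.sum_congr rfl fun x hx => ?_
    rw [(Finset.mem_filter.1 hx).2]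
  simp_rw [h3, add_mul, Finset.sum_add_distrib, one_mul, sum_stdChar_mul, if_neg hc, mul_comm c,
    sum_eta_mul_stdChar hF, ← mul_assoc, card_mul_normGauss]
  ring

end Scalars

/-! ### Congruence and quadratic forms. -/

/-- Congruence of square matrices. -/
def MatCongr {ι F : Type*} [Fintype ι] [DecidableEq ι] [Field F] (A B : Matrix ι ι F) : Prop :=
  ∃ M : Matrix ι ι F, IsUnit M ∧ A = M * B * Mᵀ

section MatCongr

variable {ι F : Type*} [Fintype ι] [DecidableEq ι] [Field F] {A B C : Matrix ι ι F}

theorem isUnit_transpose_of_isUnit {M : Matrix ι ι F} (h : IsUnit M) : IsUnit Mᵀ := by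
  rw [isUnit_iff_isUnit_det] at h ⊢
  rwa [det_transpose]

theorem MatCongr.trans (h : MatCongr A B) (h' : MatCongr B C) : MatCongr A C := by
  obtain ⟨M, hM, rfl⟩ := h
  obtain ⟨N, hN, rfl⟩ := h'
  exact ⟨M * N, hM.mul hN, by simp only [transpose_mul, Matrix.mul_assoc]⟩

theorem MatCongr.symm (h : MatCongr A B) : MatCongr B A := by
  obtain ⟨M, hM, rfl⟩ := h
  have hd := (isUnit_iff_isUnit_det M).1 hM
  refine ⟨M⁻¹, isUnit_nonsing_inv_iff.2 hM, ?_⟩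
  have hd' : IsUnit Mᵀ.det := by rwa [det_transpose]
  rw [transpose_nonsing_inv, ← Matrix.mul_assoc, ← Matrix.mul_assoc, nonsing_inv_mul _ hd,
    Matrix.one_mul, mul_nonsing_inv_cancel_right _ _ hd']

theorem MatCongr.rank_eq (h : MatCongr A B) : A.rank = B.rank := by
  obtain ⟨M, hM, rfl⟩ := h
  rw [rank_mul_eq_left_of_isUnit_det, rank_mul_eq_right_of_isUnit_det]
  · exact (isUnit_iff_isUnit_det M).1 hM
  · rw [det_transpose]
    exact (isUnit_iff_isUnit_det M).1 hM

theorem MatCongr.isSymm (h : MatCongr A B) (hB : B.IsSymm) : A.IsSymm := by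
  obtain ⟨M, -, rfl⟩ := h
  simp only [Matrix.IsSymm, transpose_mul, transpose_transpose, hB.eq, Matrix.mul_assoc]

theorem MatCongr.smul (h : MatCongr A B) (c : F) : MatCongr (c • A) (c • B) := by
  obtain ⟨M, hM, rfl⟩ := h
  exact ⟨M, hM, by simp⟩

/-- The value of the quadratic form of a matrix. -/
def quadVal {ι F : Type*} [Fintype ι] [Field F] (A : Matrix ι ι F) (x : ι → F) : F :=
  x ⬝ᵥ A *ᵥ x

omit [DecidableEq ι] in
theorem quadVal_mul_mul_transpose (M A : Matrix ι ι F) (x : ι → F) :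
    quadVal (M * A * Mᵀ) x = quadVal A (Mᵀ *ᵥ x) := by
  simp only [quadVal, ← mulVec_mulVec]
  rw [dotProduct_mulVec, ← mulVec_transpose]

omit [DecidableEq ι] in
theorem quadVal_smul (c : F) (A : Matrix ι ι F) (x : ι → F) :
    quadVal (c • A) x = c * quadVal A x := by
  simp [quadVal, smul_mulVec]

theorem quadVal_diagonal (d : ι → F) (x : ι → F) :
    quadVal (diagonal d) x = ∑ i, d i * x i ^ 2 := by
  simp only [quadVal, dotProduct, mulVec_diagonal]
  exact Finset.sum_congr rfl fun i _ => by ring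

end MatCongr

/-! ### Exponential sums of quadratic forms; the diagonal case factors over coordinates. -/

section ExpSum

variable {ι F : Type*} [Fintype ι] [DecidableEq ι] [Field F] [Fintype F] [DecidableEq F]

/-- The exponential sum of the quadratic form of a matrix. -/
noncomputable def expSum (A : Matrix ι ι F) : ℂ := ∑ x : ι → F, stdChar F (quadVal A x)

omit [DecidableEq F] in
theorem mulVec_bijective_of_isUnit {M : Matrix ι ι F} (hM : IsUnit M) :
    Function.Bijective fun x : ι → F => M *ᵥ x :=
  Finite.injective_iff_bijective.1 (mulVec_injective_of_isUnit hM)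

omit [DecidableEq F] in
theorem MatCongr.expSum_eq {A B : Matrix ι ι F} (h : MatCongr A B) : expSum A = expSum B := by
  obtain ⟨M, hM, rfl⟩ := h
  refine Fintype.sum_bijective _ (mulVec_bijective_of_isUnit (isUnit_transpose_of_isUnit hM)) _ _
    fun x => ?_
  rw [quadVal_mul_mul_transpose]

omit [DecidableEq F] [Fintype ι] [DecidableEq ι] in
theorem stdChar_sum (s : Finset ι) (f : ι → F) :
    stdChar F (∑ i ∈ s, f i) = ∏ i ∈ s, stdChar F (f i) := by
  classical
  induction s using Finset.induction_on with
  | empty => simp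
  | insert a s ha ih => rw [Finset.sum_insert ha, Finset.prod_insert ha, AddChar.map_add_eq_mul, ih]

theorem expSum_diagonal (hF : ringChar F ≠ 2) (d : ι → F) :
    expSum (diagonal d) =
      ∏ i, ((Fintype.card F : ℂ) * if d i = 0 then 1 else normGauss F * eta (d i)) := by
  simp_rw [← sum_stdChar_mul_sq hF, Finset.prod_univ_sum, Fintype.piFinset_univ, expSum,
    quadVal_diagonal, stdChar_sum]

omit [Fintype F] in
theorem card_filter_ne_zero_eq_rank (d : ι → F) :
    (Finset.univ.filter fun i => d i ≠ 0).card = (diagonal d).rank := by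
  rw [rank_diagonal, Fintype.card_subtype]

theorem expSum_diagonal_eq_rank (hF : ringChar F ≠ 2) (d : ι → F) :
    expSum (diagonal d) = Fintype.card F ^ Fintype.card ι * normGauss F ^ (diagonal d).rank *
      ∏ i ∈ Finset.univ.filter (fun i => d i ≠ 0), eta (d i) := by
  rw [expSum_diagonal hF, Finset.prod_mul_distrib, Finset.prod_const, Finset.card_univ,
    ← card_filter_ne_zero_eq_rank, mul_assoc, ← Finset.prod_const, ← Finset.prod_mul_distrib,
    Finset.prod_filter]
  congr 1
  exact Finset.prod_congr rfl fun i _ => by by_cases h : d i = 0 <;> simp [h]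

theorem expSum_smul_diagonal (hF : ringChar F ≠ 2) (d : ι → F) {c : F} (hc : c ≠ 0) :
    expSum (c • diagonal d) = eta c ^ (diagonal d).rank * expSum (diagonal d) := by
  rw [← diagonal_smul, expSum_diagonal hF, expSum_diagonal hF, ← card_filter_ne_zero_eq_rank,
    ← Finset.prod_const, Finset.prod_filter, ← Finset.prod_mul_distrib]
  refine Finset.prod_congr rfl fun i _ => ?_
  by_cases h : d i = 0
  · simp [h]
  · simp [h, hc, eta_mul]
    ring

end ExpSum

/-! ### Bordered matrices. -/

section Bordered

variable {F : Type*} {n : ℕ}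

/-- The bordered matrix with the `p`-th row and column given by the diagonal entry `d` and the
vector `x`, the remaining entries being those of `B`. -/
def bordered (p : Fin (n + 1)) (d : F) (x : Fin n → F) (B : Matrix (Fin n) (Fin n) F) :
    Matrix (Fin (n + 1)) (Fin (n + 1)) F :=
  p.insertNth (p.insertNth d x) fun i => p.insertNth (x i) (B i)

@[simp] theorem bordered_same (p : Fin (n + 1)) (d : F) (x : Fin n → F)
    (B : Matrix (Fin n) (Fin n) F) : bordered p d x B p p = d := by
  simp [bordered]

@[simp] theorem bordered_same_succAbove (p : Fin (n + 1)) (d : F) (x : Fin n → F)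
    (B : Matrix (Fin n) (Fin n) F) (j : Fin n) : bordered p d x B p (p.succAbove j) = x j := by
  simp [bordered]

@[simp] theorem bordered_succAbove_same (p : Fin (n + 1)) (d : F) (x : Fin n → F)
    (B : Matrix (Fin n) (Fin n) F) (i : Fin n) : bordered p d x B (p.succAbove i) p = x i := by
  simp [bordered]

@[simp] theorem bordered_succAbove (p : Fin (n + 1)) (d : F) (x : Fin n → F)
    (B : Matrix (Fin n) (Fin n) F) (i j : Fin n) :
    bordered p d x B (p.succAbove i) (p.succAbove j) = B i j := by
  simp [bordered]

theorem eq_bordered (p : Fin (n + 1)) {A : Matrix (Fin (n + 1)) (Fin (n + 1)) F}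
    (hA : A.IsSymm) : A = bordered p (A p p) (fun j => A p (p.succAbove j))
      (A.submatrix p.succAbove p.succAbove) := by
  ext i j
  induction i using Fin.succAboveCases p <;> induction j using Fin.succAboveCases p <;>
    simp [hA.apply]

theorem isSymm_bordered (p : Fin (n + 1)) (d : F) (x : Fin n → F)
    {B : Matrix (Fin n) (Fin n) F} (hB : B.IsSymm) : (bordered p d x B).IsSymm := by
  ext i j
  induction i using Fin.succAboveCases p <;> induction j using Fin.succAboveCases p <;>
    simp [hB.apply]

theorem bordered_mul [Field F] (p : Fin (n + 1)) (d e : F) (B C : Matrix (Fin n) (Fin n) F) :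
    bordered p d 0 B * bordered p e 0 C = bordered p (d * e) 0 (B * C) := by
  ext i j
  induction i using Fin.succAboveCases p <;> induction j using Fin.succAboveCases p <;>
    simp [mul_apply, Fin.sum_univ_succAbove _ p]

theorem bordered_transpose [Field F] (p : Fin (n + 1)) (d : F) (x : Fin n → F)
    (B : Matrix (Fin n) (Fin n) F) : (bordered p d x B)ᵀ = bordered p d x Bᵀ := by
  ext i j
  induction i using Fin.succAboveCases p <;> induction j using Fin.succAboveCases p <;> simp

theorem bordered_one [Field F] (p : Fin (n + 1)) :
    bordered p (1 : F) 0 (1 : Matrix (Fin n) (Fin n) F) = 1 := by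
  ext i j
  induction i using Fin.succAboveCases p <;> induction j using Fin.succAboveCases p <;>
    simp [one_apply, Fin.ne_succAbove, Fin.succAbove_ne]

theorem MatCongr.bordered [Field F] {A B : Matrix (Fin n) (Fin n) F} (h : MatCongr A B)
    (p : Fin (n + 1)) (d : F) : MatCongr (bordered p d 0 A) (bordered p d 0 B) := by
  obtain ⟨M, hM, rfl⟩ := h
  refine ⟨_root_.bordered p 1 0 M, ?_, ?_⟩
  · have hd := (isUnit_iff_isUnit_det M).1 hM
    refine isUnit_iff_exists.2 ⟨_root_.bordered p 1 0 M⁻¹, ?_, ?_⟩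
    · rw [bordered_mul, mul_nonsing_inv _ hd, one_mul, bordered_one]
    · rw [bordered_mul, nonsing_inv_mul _ hd, one_mul, bordered_one]
  · simp [bordered_transpose, bordered_mul]

theorem quadVal_bordered [Field F] (p : Fin (n + 1)) (d : F) (x : Fin n → F)
    (B : Matrix (Fin n) (Fin n) F) (s : F) (v : Fin n → F) :
    quadVal (bordered p d x B) (p.insertNth s v : Fin (n + 1) → F) =
      d * s ^ 2 + 2 * s * (x ⬝ᵥ v) + quadVal B v := by
  simp only [quadVal, dotProduct, mulVec, Fin.sum_univ_succAbove _ p, Fin.insertNth_apply_same,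
    Fin.insertNth_apply_succAbove, bordered_same, bordered_same_succAbove,
    bordered_succAbove_same, bordered_succAbove, mul_add, Finset.sum_add_distrib]
  have h : ∑ i, v i * (x i * s) = s * ∑ i, x i * v i := by
    rw [Finset.mul_sum]
    exact Finset.sum_congr rfl fun i _ => by ring
  rw [h]
  ring

end Bordered

/-! ### Diagonalisation and reduction to normal form. -/

section NormalForm

variable {F : Type*} [Field F] {n : ℕ}

/-- A nonzero vector is the first column of an invertible matrix. -/
theorem exists_isUnit_col_zero {x : Fin (n + 1) → F} (hx : x ≠ 0) :
    ∃ P : Matrix (Fin (n + 1)) (Fin (n + 1)) F, IsUnit P ∧ ∀ i, P i 0 = x i := by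
  obtain ⟨j, hj⟩ := Function.ne_iff.1 hx
  -- The identity with column `j` replaced by `x` has determinant `x j` by Cramer's rule; swapping
  -- columns `0` and `j` changes only the sign.
  refine ⟨((1 : Matrix _ _ F).updateCol j x).submatrix id (Equiv.swap 0 j), ?_, fun i => by simp⟩
  rw [isUnit_iff_isUnit_det, det_permute', ← cramer_apply, cramer_one]
  have : IsUnit (x j) := isUnit_iff_ne_zero.2 hj
  simp only [Module.End.one_apply]
  refine IsUnit.mul ?_ this
  rw [isUnit_iff_ne_zero]
  rcases Int.units_eq_one_or (Equiv.Perm.sign (Equiv.swap 0 j)) with h | h <;> simp [h]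

/-- Splitting off a vector on which the quadratic form does not vanish. -/
theorem exists_congr_bordered {A : Matrix (Fin (n + 1)) (Fin (n + 1)) F} (hA : A.IsSymm)
    {x : Fin (n + 1) → F} {a : F} (ha : a ≠ 0) (hx : quadVal A x = a) :
    ∃ B : Matrix (Fin n) (Fin n) F, B.IsSymm ∧ MatCongr A (bordered 0 a 0 B) := by
  have hx0 : x ≠ 0 := by
    rintro rfl
    exact ha (by rw [← hx]; simp [quadVal])
  obtain ⟨P, hP, hPx⟩ := exists_isUnit_col_zero hx0
  set C : Matrix (Fin (n + 1)) (Fin (n + 1)) F := Pᵀ * A * P with hC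
  have hCA : MatCongr C A :=
    ⟨Pᵀ, isUnit_transpose_of_isUnit hP, by rw [transpose_transpose]⟩
  have hCs := hCA.isSymm hA
  have hC0 : C 0 0 = a := by
    have : P.col 0 = x := funext hPx
    rw [← hx, hC, quadVal, ← this]
    simp only [mul_apply, dotProduct, mulVec, Finset.sum_mul, Finset.mul_sum, transpose_apply,
      col_apply]
    rw [Finset.sum_comm]
    exact Finset.sum_congr rfl fun i _ => Finset.sum_congr rfl fun j _ => by ring
  set y : Fin n → F := fun j => C 0 j.succ with hy
  -- The Schur complement of the pivot `a`; the lower unitriangular `L` below is the elimination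
  -- matrix undoing it.
  set B : Matrix (Fin n) (Fin n) F := fun i j => C i.succ j.succ - y i * y j / a with hB
  have hBs : B.IsSymm := by
    ext i j
    change C j.succ i.succ - y j * y i / a = C i.succ j.succ - y i * y j / a
    rw [hCs.apply, mul_comm]
  set L : Matrix (Fin (n + 1)) (Fin (n + 1)) F :=
    fun i j => if i = j then 1 else if j = 0 then C 0 i / a else 0 with hL
  refine ⟨B, hBs, hCA.symm.trans ⟨L, ?_, ?_⟩⟩
  · have ht : L.BlockTriangular OrderDual.toDual := by
      intro i j hij
      have hij' : i < j := hij
      simp [hL, hij'.ne, ((Fin.zero_le i).trans_lt hij').ne']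
    rw [isUnit_iff_isUnit_det, det_of_isLowerTriangular L ht]
    simp [hL]
  · have e00 : bordered 0 a 0 B 0 0 = a := bordered_same 0 a 0 B
    have e01 : ∀ j : Fin n, bordered 0 a 0 B 0 j.succ = 0 := fun j =>
      bordered_same_succAbove 0 a 0 B j
    have e10 : ∀ j : Fin n, bordered 0 a 0 B j.succ 0 = 0 := fun j =>
      bordered_succAbove_same 0 a 0 B j
    have e11 : ∀ i j : Fin n, bordered 0 a 0 B i.succ j.succ = B i j :=
      bordered_succAbove 0 a 0 B
    ext i j
    simp only [mul_apply, transpose_apply, Fin.sum_univ_succ (n := n), e00, e01, e10, e11]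
    refine Fin.cases ?_ (fun i => ?_) i <;> refine Fin.cases ?_ (fun j => ?_) j
    · simp [hL, hC0, (Fin.succ_ne_zero _).symm]
    · simp [hL, (Fin.succ_ne_zero _).symm, Fin.succ_ne_zero]
      field_simp
    · simp [hL, (Fin.succ_ne_zero _).symm, Fin.succ_ne_zero]
      rw [hCs.apply]
      field_simp
    · simp [hL, Fin.succ_ne_zero, hB, hy]
      field_simp
      ring

theorem quadVal_add {A : Matrix (Fin n) (Fin n) F} (hA : A.IsSymm) (x y : Fin n → F) :
    quadVal A (x + y) = quadVal A x + 2 * (x ⬝ᵥ A *ᵥ y) + quadVal A y := by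
  have h : y ⬝ᵥ A *ᵥ x = x ⬝ᵥ A *ᵥ y := by
    rw [dotProduct_mulVec, ← mulVec_transpose, hA.eq, dotProduct_comm]
  simp only [quadVal, mulVec_add, dotProduct_add, add_dotProduct, h]
  ring

/-- By polarisation on basis vectors, a form vanishing identically has all entries `2 * A i j` zero.
-/
theorem exists_quadVal_ne_zero (h2 : (2 : F) ≠ 0) {A : Matrix (Fin n) (Fin n) F} (hA : A.IsSymm)
    (h : A ≠ 0) : ∃ x, quadVal A x ≠ 0 := by
  by_contra! H
  refine h ?_
  ext i j
  have h1 := quadVal_add hA (Pi.single i 1) (Pi.single j 1)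
  simp only [H, zero_add, add_zero] at h1
  have h3 := (mul_eq_zero.1 h1.symm).resolve_left h2
  simpa using h3

end NormalForm

section NormalFormExists

variable {F : Type*} [Field F] {n : ℕ}

@[simp] theorem normalForm_rank_zero (n : ℕ) (δ : F) : normalForm n 0 δ = 0 := by
  simp [normalForm]

theorem normalForm_succ_one (n : ℕ) (δ : F) :
    normalForm (n + 1) 1 δ = bordered 0 δ 0 0 := by
  ext i j
  refine Fin.cases ?_ (fun i => ?_) i <;> refine Fin.cases ?_ (fun j => ?_) j
  · simp [normalForm]
  · simpa [normalForm, (Fin.succ_ne_zero _).symm] using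
      (bordered_same_succAbove 0 δ 0 (0 : Matrix (Fin n) (Fin n) F) j).symm
  · simpa [normalForm, Fin.succ_ne_zero] using
      (bordered_succAbove_same 0 δ 0 (0 : Matrix (Fin n) (Fin n) F) i).symm
  · simpa [normalForm, diagonal_apply] using
      (bordered_succAbove 0 δ 0 (0 : Matrix (Fin n) (Fin n) F) i j).symm

theorem normalForm_succ_succ (n : ℕ) {r : ℕ} (hr : r ≠ 0) (δ : F) :
    normalForm (n + 1) (r + 1) δ = bordered 0 1 0 (normalForm n r δ) := by
  ext i j
  have h0 : 0 < r := Nat.pos_of_ne_zero hr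
  refine Fin.cases ?_ (fun i => ?_) i <;> refine Fin.cases ?_ (fun j => ?_) j
  · simp [normalForm, h0]
  · simpa [normalForm, (Fin.succ_ne_zero _).symm] using
      (bordered_same_succAbove 0 1 0 (normalForm n r δ) j).symm
  · simpa [normalForm, Fin.succ_ne_zero] using
      (bordered_succAbove_same 0 1 0 (normalForm n r δ) i).symm
  · have := (bordered_succAbove 0 1 0 (normalForm n r δ) i j).symm
    simpa [normalForm, diagonal_apply] using this

theorem rank_normalForm {n r : ℕ} (hr : r ≤ n) {δ : F} (hδ : δ ≠ 0) :
    (normalForm n r δ).rank = r := by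
  classical
  rw [normalForm, rank_diagonal, Fintype.card_subtype]
  have : (Finset.univ.filter fun i : Fin n =>
      (if (i : ℕ) + 1 < r then 1 else if (i : ℕ) + 1 = r then δ else 0) ≠ 0) =
      Finset.univ.filter fun i : Fin n => (i : ℕ) < r := by
    refine Finset.filter_congr fun i _ => ?_
    split_ifs with h1 h2
    · simp; omega
    · simp [hδ]; omega
    · simp; omega
  rw [this, Fin.card_filter_val_lt, min_eq_right hr]

theorem congr_normalForm_of_isSquare (n r : ℕ) {δ : F} (hδ : δ ≠ 0) (h : IsSquare δ) :
    MatCongr (normalForm n r δ) (normalForm n r 1) := by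
  obtain ⟨c, rfl⟩ := h
  have hc : c ≠ 0 := by
    rintro rfl
    simp at hδ
  refine ⟨diagonal fun i : Fin n => if (i : ℕ) + 1 = r then c else 1, ?_, ?_⟩
  · rw [isUnit_iff_isUnit_det, det_diagonal, isUnit_iff_ne_zero, Finset.prod_ne_zero_iff]
    intro i _
    split_ifs <;> simp [hc]
  · rw [diagonal_transpose, normalForm, normalForm, diagonal_mul_diagonal, diagonal_mul_diagonal]
    congr 1
    funext i
    split_ifs with h1 h2 <;> simp
    omega

variable [Fintype F]

/-- Both `a * s ^ 2` and `1 - b * t ^ 2` take more than half of the values of the field, so they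
meet. This allows every pivot but the last to be 1. -/
theorem exists_mul_sq_add_mul_sq (hF : ringChar F ≠ 2) {a b : F} (ha : a ≠ 0) (hb : b ≠ 0) :
    ∃ s t : F, a * s ^ 2 + b * t ^ 2 = 1 := by
  classical
  open Polynomial in
  obtain ⟨s, t, h⟩ := FiniteField.exists_root_sum_quadratic (R := F)
    (f := C a * X ^ 2 + C 0 * X + C 0) (g := C b * X ^ 2 + C 0 * X + C (-1))
    (degree_quadratic ha) (degree_quadratic hb) (FiniteField.odd_card_of_char_ne_two hF)
  refine ⟨s, t, ?_⟩
  simp at h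
  linear_combination h

/-- Every symmetric matrix over a finite field of odd characteristic is congruent to a normal
form. -/
theorem exists_congr_normalForm (hF : ringChar F ≠ 2) {A : Matrix (Fin n) (Fin n) F}
    (hA : A.IsSymm) : ∃ r ≤ n, ∃ δ : F, δ ≠ 0 ∧ MatCongr A (normalForm n r δ) := by
  have h2 : (2 : F) ≠ 0 := Ring.two_ne_zero hF
  induction n with
  | zero => exact ⟨0, le_rfl, 1, one_ne_zero, 1, isUnit_one, Subsingleton.elim _ _⟩
  | succ n ih =>
    rcases eq_or_ne A 0 with rfl | hA0
    · exact ⟨0, Nat.zero_le _, 1, one_ne_zero, 1, isUnit_one, by simp⟩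
    obtain ⟨x, hx⟩ := exists_quadVal_ne_zero h2 hA hA0
    obtain ⟨B, hB, hAB⟩ := exists_congr_bordered hA hx rfl
    rcases eq_or_ne B 0 with rfl | hB0
    · exact ⟨1, by omega, _, hx, by rwa [normalForm_succ_one]⟩
    obtain ⟨v, hv⟩ := exists_quadVal_ne_zero h2 hB hB0
    -- A nonzero `B` supplies a second nonzero value, so the form takes the value 1 at `(s, t • v)`;
    -- `w` is this vector in the original coordinates.
    obtain ⟨s, t, hst⟩ := exists_mul_sq_add_mul_sq hF hx hv
    obtain ⟨M, hM, hAM⟩ := hAB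
    obtain ⟨w, hw⟩ := (mulVec_bijective_of_isUnit (isUnit_transpose_of_isUnit hM)).2
      (Fin.insertNth 0 s (t • v) : Fin (n + 1) → F)
    have h1 : quadVal A w = 1 := by
      rw [hAM, quadVal_mul_mul_transpose]
      refine (congrArg _ hw).trans ?_
      rw [quadVal_bordered, ← hst]
      simp only [quadVal, mulVec_smul, dotProduct_smul, smul_dotProduct, zero_dotProduct,
        smul_eq_mul]
      ring
    obtain ⟨C, hC, hAC⟩ := exists_congr_bordered hA one_ne_zero h1
    obtain ⟨r, hr, δ, hδ, hCr⟩ := ih hC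
    rcases eq_or_ne r 0 with rfl | hr0
    · refine ⟨1, by omega, 1, one_ne_zero, hAC.trans ?_⟩
      rw [normalForm_succ_one]
      simpa using hCr.bordered 0 1
    · refine ⟨r + 1, by omega, δ, hδ, hAC.trans ?_⟩
      rw [normalForm_succ_succ n hr0]
      exact hCr.bordered 0 1

end NormalFormExists

/-! ### The quadratic character as a normalised exponential sum. -/

section Character

variable {F : Type*} [Field F] [Fintype F] [DecidableEq F] {n : ℕ}

/-- The quadratic character of a symmetric matrix, read off its exponential sum. -/
noncomputable def quadChi (A : Matrix (Fin n) (Fin n) F) : ℂ :=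
  expSum A / (Fintype.card F ^ n * normGauss F ^ A.rank)

theorem expSum_eq_quadChi (hF : ringChar F ≠ 2) (A : Matrix (Fin n) (Fin n) F) :
    expSum A = Fintype.card F ^ n * normGauss F ^ A.rank * quadChi A := by
  rw [quadChi, mul_div_cancel₀]
  exact mul_ne_zero (pow_ne_zero _ card_complex_ne_zero) (pow_ne_zero _ (normGauss_ne_zero hF))

theorem MatCongr.quadChi_eq {A B : Matrix (Fin n) (Fin n) F} (h : MatCongr A B) :
    quadChi A = quadChi B := by
  rw [quadChi, quadChi, h.expSum_eq, h.rank_eq]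

theorem quadChi_diagonal (hF : ringChar F ≠ 2) (d : Fin n → F) :
    quadChi (diagonal d) = ∏ i ∈ Finset.univ.filter (fun i => d i ≠ 0), eta (d i) := by
  have h : (Fintype.card F : ℂ) ^ n * normGauss F ^ (diagonal d).rank ≠ 0 :=
    mul_ne_zero (pow_ne_zero _ card_complex_ne_zero) (pow_ne_zero _ (normGauss_ne_zero hF))
  rw [quadChi, expSum_diagonal_eq_rank hF, Fintype.card_fin, mul_div_cancel_left₀ _ h]

theorem quadChi_normalForm (hF : ringChar F ≠ 2) {r : ℕ} (hr : r ≠ 0) (hrn : r ≤ n) {δ : F}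
    (hδ : δ ≠ 0) : quadChi (normalForm n r δ) = eta δ := by
  rw [normalForm, quadChi_diagonal hF, Finset.prod_filter,
    Finset.prod_eq_single (⟨r - 1, by omega⟩ : Fin n)]
  · simp [Nat.sub_add_cancel (Nat.pos_of_ne_zero hr), hδ]
  · intro i _ hi
    have : (i : ℕ) + 1 ≠ r := fun h => hi (Fin.ext (by simp; omega))
    by_cases h1 : (i : ℕ) + 1 < r <;> simp [this, h1]
  · simp

theorem quadChi_zero (hF : ringChar F ≠ 2) : quadChi (0 : Matrix (Fin n) (Fin n) F) = 1 := by
  rw [← diagonal_zero, quadChi_diagonal hF]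
  simp

theorem quadChi_sq (hF : ringChar F ≠ 2) {A : Matrix (Fin n) (Fin n) F} (hA : A.IsSymm) :
    quadChi A ^ 2 = 1 := by
  obtain ⟨r, hr, δ, hδ, h⟩ := exists_congr_normalForm hF hA
  rw [h.quadChi_eq]
  rcases eq_or_ne r 0 with rfl | hr0
  · rw [normalForm_rank_zero, quadChi_zero hF, one_pow]
  · rw [quadChi_normalForm hF hr0 hr hδ, eta_sq hδ]

theorem quadChi_of_hasCharacter (hF : ringChar F ≠ 2) {A : Matrix (Fin n) (Fin n) F} {ε : ℤˣ}
    (h : HasCharacter A ε) : quadChi A = ((ε : ℤ) : ℂ) := by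
  have hr : A.rank ≤ n := by simpa using A.rank_le_width
  rcases h with ⟨rfl, hc⟩ | ⟨rfl, h0, z, M, hz, hc⟩
  · rw [MatCongr.quadChi_eq hc]
    rcases eq_or_ne A.rank 0 with h | h
    · simp [h, quadChi_zero hF]
    · simp [quadChi_normalForm hF h hr]
  · have hz0 : z ≠ 0 := by
      rintro rfl
      exact hz IsSquare.zero
    have h : A.rank ≠ 0 := by
      intro h
      rw [h, normalForm_rank_zero] at hc
      simp [hc.2] at h0
    rw [MatCongr.quadChi_eq ⟨M, hc⟩, quadChi_normalForm hF h hr hz0, eta_of_not_isSquare hz]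
    simp

theorem exists_hasCharacter (hF : ringChar F ≠ 2) {A : Matrix (Fin n) (Fin n) F}
    (hA : A.IsSymm) : ∃ ε : ℤˣ, HasCharacter A ε := by
  obtain ⟨r, hr, δ, hδ, h⟩ := exists_congr_normalForm hF hA
  have hrk : A.rank = r := h.rank_eq.trans (rank_normalForm hr hδ)
  subst hrk
  by_cases hs : IsSquare δ
  · exact ⟨1, Or.inl ⟨rfl, h.trans (congr_normalForm_of_isSquare n _ hδ hs)⟩⟩
  · rcases eq_or_ne A 0 with rfl | h0
    · exact ⟨1, Or.inl ⟨rfl, 1, isUnit_one, by simp⟩⟩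
    · exact ⟨-1, Or.inr ⟨rfl, h0, δ, h.imp fun M hM => ⟨hs, hM⟩⟩⟩

/-- Some character exists by the normal form, and the exponential sum, a congruence invariant,
singles it out. In particular the two characters exclude each other. -/
theorem hasCharacter_iff (hF : ringChar F ≠ 2) {A : Matrix (Fin n) (Fin n) F} (hA : A.IsSymm)
    (ε : ℤˣ) : HasCharacter A ε ↔ quadChi A = ((ε : ℤ) : ℂ) := by
  refine ⟨quadChi_of_hasCharacter hF, fun h => ?_⟩
  obtain ⟨ε', h'⟩ := exists_hasCharacter hF hA
  have h1 := (quadChi_of_hasCharacter hF h').symm.trans h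
  have h2 : ε' = ε := Units.ext (by exact_mod_cast h1)
  rwa [← h2]

/-- Rank and character are determined by the exponential sum. -/
theorem rank_and_quadChi_of_expSum_eq (hF : ringChar F ≠ 2) {A : Matrix (Fin n) (Fin n) F}
    (hA : A.IsSymm) {r : ℕ} {c : ℂ} (hc : c ^ 2 = 1)
    (h : expSum A = Fintype.card F ^ n * normGauss F ^ r * c) : A.rank = r ∧ quadChi A = c := by
  have hq : (Fintype.card F : ℂ) ^ n ≠ 0 := pow_ne_zero _ card_complex_ne_zero
  have hn : ∀ z : ℂ, z ^ 2 = 1 → ‖z‖ = 1 := by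
    intro z hz
    rcases mul_self_eq_one_iff.1 ((sq z).symm.trans hz) with rfl | rfl <;> simp
  have h1 := expSum_eq_quadChi hF A
  rw [h, mul_assoc, mul_assoc] at h1
  have h2 := mul_left_cancel₀ hq h1
  -- Both signs have norm 1, so comparing norms isolates the power of `|γ|`.
  have h3 : r = A.rank := by
    refine norm_normGauss_pow_injective hF ?_
    have := congrArg norm h2
    simpa [hn _ hc, hn _ (quadChi_sq hF hA)] using this
  subst h3
  exact ⟨rfl, (mul_left_cancel₀ (pow_ne_zero _ (normGauss_ne_zero hF)) h2).symm⟩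

theorem expSum_smul (hF : ringChar F ≠ 2) {A : Matrix (Fin n) (Fin n) F} (hA : A.IsSymm) {c : F}
    (hc : c ≠ 0) : expSum (c • A) = eta c ^ A.rank * expSum A := by
  obtain ⟨r, hr, δ, hδ, h⟩ := exists_congr_normalForm hF hA
  rw [(h.smul c).expSum_eq, h.expSum_eq, h.rank_eq, normalForm, expSum_smul_diagonal hF _ hc]

theorem rank_and_quadChi_smul (hF : ringChar F ≠ 2) {A : Matrix (Fin n) (Fin n) F}
    (hA : A.IsSymm) {c : F} (hc : c ≠ 0) :
    (c • A).rank = A.rank ∧ quadChi (c • A) = eta c ^ A.rank * quadChi A := by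
  refine rank_and_quadChi_of_expSum_eq hF ?_ ?_ ?_
  · rw [Matrix.IsSymm, transpose_smul, hA.eq]
  · rw [mul_pow, quadChi_sq hF hA, ← pow_mul, mul_comm A.rank, pow_mul, eta_sq hc, one_pow, one_mul]
  · rw [expSum_smul hF hA hc, expSum_eq_quadChi hF A]
    ring

end Character

/-! ### Rank and character of a bordered matrix; value distribution of a quadratic form. -/

section BorderedCharacter

variable {F : Type*} [Field F] [Fintype F] [DecidableEq F] {n : ℕ}

omit [DecidableEq F] in
theorem expSum_bordered (p : Fin (n + 1)) (d : F) (x : Fin n → F) (B : Matrix (Fin n) (Fin n) F) :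
    expSum (bordered p d x B) =
      ∑ s : F, ∑ v : Fin n → F, stdChar F (d * s ^ 2 + 2 * s * (x ⬝ᵥ v) + quadVal B v) := by
  rw [expSum, ← (Fin.insertNthEquiv (fun _ => F) p).sum_comp, Fintype.sum_prod_type]
  exact Finset.sum_congr rfl fun s _ => Finset.sum_congr rfl fun v _ =>
    congrArg _ (quadVal_bordered p d x B s v)

theorem exists_stdChar_mul_ne_one {a : F} (ha : a ≠ 0) : ∃ t, stdChar F (a * t) ≠ 1 := by
  by_contra! h
  have := sum_stdChar_mul a
  simp [h, ha] at this

-- A functional killing the range but not `x` is the dot product with some `z`; symmetry of `B`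
-- turns "kills the range" into `B *ᵥ z = 0`.
omit [Fintype F] [DecidableEq F] in
theorem exists_mulVec_eq_zero_of_notMem_range {B : Matrix (Fin n) (Fin n) F} (hB : B.IsSymm)
    {x : Fin n → F} (hx : x ∉ Set.range (B *ᵥ ·)) : ∃ z, B *ᵥ z = 0 ∧ x ⬝ᵥ z ≠ 0 := by
  have hx' : x ∉ LinearMap.range B.mulVecLin := by
    simpa using hx
  obtain ⟨f, hfx, hf⟩ := Submodule.exists_le_ker_of_notMem hx'
  set z : Fin n → F := fun i => f fun j => if i = j then 1 else 0 with hz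
  have hfd : ∀ v, f v = v ⬝ᵥ z := fun v => LinearMap.pi_apply_eq_sum_univ f v
  refine ⟨z, ?_, by rwa [← hfd]⟩
  ext i
  have h1 : f (B *ᵥ Pi.single i 1) = 0 := hf ⟨_, rfl⟩
  rw [hfd, mulVec_single_one] at h1
  simpa [mulVec, dotProduct, hB.apply] using h1

/-- For `s ≠ 0`, translating `v` along a kernel vector not orthogonal to `x` multiplies the inner
sum by a factor that can be chosen different from 1, so it vanishes. Only `s = 0` survives. -/
theorem expSum_bordered_of_notMem_range (hF : ringChar F ≠ 2) {B : Matrix (Fin n) (Fin n) F}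
    (hB : B.IsSymm) (p : Fin (n + 1)) (d : F) {x : Fin n → F}
    (hx : x ∉ Set.range (B *ᵥ ·)) : expSum (bordered p d x B) = expSum B := by
  obtain ⟨z, hz, hxz⟩ := exists_mulVec_eq_zero_of_notMem_range hB hx
  rw [expSum_bordered, Finset.sum_eq_single 0]
  · simp [expSum]
  · intro s _ hs
    have ha : 2 * s * (x ⬝ᵥ z) ≠ 0 :=
      mul_ne_zero (mul_ne_zero (Ring.two_ne_zero hF) hs) hxz
    obtain ⟨t, ht⟩ := exists_stdChar_mul_ne_one ha
    set T := ∑ v : Fin n → F, stdChar F (d * s ^ 2 + 2 * s * (x ⬝ᵥ v) + quadVal B v) with hT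
    have h : T = stdChar F (2 * s * (x ⬝ᵥ z) * t) * T := by
      conv_lhs => rw [hT, ← Equiv.sum_comp (Equiv.addRight (t • z))]
      rw [hT, Finset.mul_sum]
      refine Finset.sum_congr rfl fun v _ => ?_
      have hq : quadVal B (t • z) = 0 := by simp [quadVal, mulVec_smul, hz]
      rw [← AddChar.map_add_eq_mul, Equiv.coe_addRight, quadVal_add hB, hq, mulVec_smul, hz,
        dotProduct_add, dotProduct_smul]
      congr 1
      simp
      ring
    have h' : (stdChar F (2 * s * (x ⬝ᵥ z) * t) - 1) * T = 0 := by linear_combination -h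
    exact (mul_eq_zero.1 h').resolve_left (sub_ne_zero.2 ht)
  · simp

/-- Completing the square by `v ↦ v + s • y` separates `s` from `v`, with `d - quadVal B y` as
coefficient of `s ^ 2`. -/
theorem expSum_bordered_mulVec (hF : ringChar F ≠ 2) {B : Matrix (Fin n) (Fin n) F}
    (hB : B.IsSymm) (p : Fin (n + 1)) (d : F) (y : Fin n → F) :
    expSum (bordered p d (B *ᵥ y) B) = Fintype.card F *
      (if d - quadVal B y = 0 then 1 else normGauss F * eta (d - quadVal B y)) * expSum B := by
  rw [expSum_bordered, ← sum_stdChar_mul_sq hF, Finset.sum_mul]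
  refine Finset.sum_congr rfl fun s _ => ?_
  rw [expSum, Finset.mul_sum]
  symm
  rw [← Equiv.sum_comp (Equiv.addRight (s • y))]
  refine Finset.sum_congr rfl fun v _ => ?_
  rw [← AddChar.map_add_eq_mul, Equiv.coe_addRight, quadVal_add hB, dotProduct_comm (B *ᵥ y)]
  congr 1
  simp only [quadVal, mulVec_smul, dotProduct_smul, smul_dotProduct, smul_eq_mul]
  ring

/-- The exponential sum is that of `B`, but the size has grown by one; `q * γ ^ 2 = η(-1)` absorbs
the extra `q` into two more powers of `γ` and a sign. -/
theorem bordered_of_notMem_range (hF : ringChar F ≠ 2) {B : Matrix (Fin n) (Fin n) F}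
    (hB : B.IsSymm) (p : Fin (n + 1)) (d : F) {x : Fin n → F} (hx : x ∉ Set.range (B *ᵥ ·)) :
    (bordered p d x B).rank = B.rank + 2 ∧
      quadChi (bordered p d x B) = eta (-1 : F) * quadChi B := by
  refine rank_and_quadChi_of_expSum_eq hF (isSymm_bordered p d x hB) ?_ ?_
  · rw [mul_pow, quadChi_sq hF hB, eta_sq (neg_ne_zero.2 one_ne_zero), one_mul]
  · rw [expSum_bordered_of_notMem_range hF hB p d hx, expSum_eq_quadChi hF B]
    have h1 := card_mul_normGauss_sq hF
    have h2 := eta_sq (neg_ne_zero.2 (one_ne_zero (α := F)))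
    rw [← h1] at h2 ⊢
    linear_combination (-(Fintype.card F : ℂ) ^ n * normGauss F ^ B.rank * quadChi B) * h2

theorem bordered_mulVec_of_eq (hF : ringChar F ≠ 2) {B : Matrix (Fin n) (Fin n) F}
    (hB : B.IsSymm) (p : Fin (n + 1)) {d : F} {y : Fin n → F} (h : d - quadVal B y = 0) :
    (bordered p d (B *ᵥ y) B).rank = B.rank ∧
      quadChi (bordered p d (B *ᵥ y) B) = quadChi B := by
  refine rank_and_quadChi_of_expSum_eq hF (isSymm_bordered p d _ hB) (quadChi_sq hF hB) ?_
  rw [expSum_bordered_mulVec hF hB, if_pos h, expSum_eq_quadChi hF B]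
  ring

theorem bordered_mulVec_of_ne (hF : ringChar F ≠ 2) {B : Matrix (Fin n) (Fin n) F}
    (hB : B.IsSymm) (p : Fin (n + 1)) {d : F} {y : Fin n → F} (h : d - quadVal B y ≠ 0) :
    (bordered p d (B *ᵥ y) B).rank = B.rank + 1 ∧
      quadChi (bordered p d (B *ᵥ y) B) = eta (d - quadVal B y) * quadChi B := by
  refine rank_and_quadChi_of_expSum_eq hF (isSymm_bordered p d _ hB) ?_ ?_
  · rw [mul_pow, quadChi_sq hF hB, eta_sq h, one_mul]
  rw [expSum_bordered_mulVec hF hB, if_neg h, expSum_eq_quadChi hF B]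
  ring

/-- The deviation of the number of zeros of a quadratic form from its mean. -/
theorem card_zeros_sub (hF : ringChar F ≠ 2) {B : Matrix (Fin n) (Fin n) F} (hB : B.IsSymm) :
    (∑ y : Fin n → F, if quadVal B y = 0 then (1 : ℂ) else 0) - Fintype.card F ^ n / Fintype.card F =
      if Even B.rank then (1 - 1 / (Fintype.card F : ℂ)) * expSum B else 0 := by
  have hq := card_complex_ne_zero (F := F)
  -- Zeros are detected by orthogonality of additive characters; the term `a = 0` is the main term.
  have h1 : (Fintype.card F : ℂ) * ∑ y : Fin n → F, (if quadVal B y = 0 then (1 : ℂ) else 0) =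
      ∑ a : F, expSum (a • B) := by
    simp_rw [expSum, quadVal_smul]
    rw [Finset.sum_comm, Finset.mul_sum]
    refine Finset.sum_congr rfl fun y _ => ?_
    simp_rw [mul_comm _ (quadVal B y), sum_stdChar_mul]
    simp
  have h2 : ∑ a : F, expSum (a • B) = (Fintype.card F : ℂ) ^ n +
      ∑ a ∈ Finset.univ.erase (0 : F), eta a ^ B.rank * expSum B := by
    rw [← Finset.add_sum_erase _ _ (Finset.mem_univ (0 : F))]
    congr 1
    · simp [expSum, quadVal]
    · exact Finset.sum_congr rfl fun a ha => expSum_smul hF hB (Finset.ne_of_mem_erase ha)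
  -- For `a ≠ 0`, `η(a) ^ rank` is 1 or `η(a)` according to parity: the source of the two cases of
  -- the recursion.
  have h3 : ∑ a ∈ Finset.univ.erase (0 : F), eta a ^ B.rank * expSum B =
      if Even B.rank then ((Fintype.card F : ℂ) - 1) * expSum B else 0 := by
    split_ifs with h
    · obtain ⟨k, hk⟩ := h
      rw [Finset.sum_congr rfl (g := fun _ => expSum B)]
      · simp [Finset.card_erase_of_mem, Nat.cast_sub Fintype.card_pos]
      · intro a ha
        rw [hk, ← two_mul, pow_mul, eta_sq (Finset.ne_of_mem_erase ha), one_pow, one_mul]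
    · obtain ⟨k, hk⟩ := Nat.not_even_iff_odd.1 h
      rw [← Finset.sum_mul, Finset.sum_congr rfl (g := fun a => eta a)]
      · have := sum_eta hF
        rw [← Finset.add_sum_erase _ _ (Finset.mem_univ (0 : F)), eta_zero, zero_add] at this
        rw [this, zero_mul]
      · intro a ha
        rw [hk, pow_succ, pow_mul, eta_sq (Finset.ne_of_mem_erase ha), one_pow, one_mul]
  rw [h2, h3] at h1
  split_ifs at h1 ⊢ <;> field_simp <;> linear_combination h1

/-- Expanding `η` through its Gauss sum brings in one more factor `η(a)` than in the count of zeros,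
so the parities trade places. -/
theorem sum_eta_quadVal (hF : ringChar F ≠ 2) {B : Matrix (Fin n) (Fin n) F} (hB : B.IsSymm) :
    quadGauss F * ∑ y : Fin n → F, eta (quadVal B y) =
      if Even B.rank then 0 else ((Fintype.card F : ℂ) - 1) * expSum B := by
  have h1 : quadGauss F * ∑ y : Fin n → F, eta (quadVal B y) =
      ∑ a : F, eta a * expSum (a • B) := by
    simp_rw [expSum, quadVal_smul, Finset.mul_sum]
    rw [Finset.sum_comm]
    exact Finset.sum_congr rfl fun y _ => by rw [sum_eta_mul_stdChar hF, mul_comm]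
  have h2 : ∀ a : F, eta a * expSum (a • B) = eta a ^ (B.rank + 1) * expSum B := by
    intro a
    rcases eq_or_ne a 0 with rfl | ha
    · simp
    · rw [expSum_smul hF hB ha]
      ring
  simp_rw [h1, h2]
  split_ifs with h
  · obtain ⟨k, hk⟩ := h
    rw [← Finset.sum_mul, Finset.sum_congr rfl (g := fun a => eta a), sum_eta hF, zero_mul]
    intro a _
    rcases eq_or_ne a 0 with rfl | ha
    · simp
    · rw [hk, ← two_mul, pow_succ, pow_mul, eta_sq ha, one_pow, one_mul]
  · obtain ⟨k, hk⟩ := Nat.not_even_iff_odd.1 h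
    rw [← Finset.sum_mul]
    congr 1
    rw [← Finset.add_sum_erase _ _ (Finset.mem_univ (0 : F)),
      Finset.sum_congr rfl (g := fun _ => (1 : ℂ))]
    · simp [Finset.card_erase_of_mem, Nat.cast_sub Fintype.card_pos]
    · intro a ha
      rw [hk, show 2 * k + 1 + 1 = 2 * (k + 1) by ring, pow_mul,
        eta_sq (Finset.ne_of_mem_erase ha), one_pow]

end BorderedCharacter

/-! ### Sums of rank and character weights over all borderings of a fixed matrix. -/

section FiberSums

variable {F : Type*} [Field F] [Fintype F] [DecidableEq F] {n : ℕ}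

omit [DecidableEq F] in
/-- Summation of a function which is constant off the range of a matrix. -/
theorem sum_eq_of_const_off_range (B : Matrix (Fin n) (Fin n) F) (f : (Fin n → F) → ℂ) (c : ℂ)
    (hf : ∀ x, x ∉ Set.range (B *ᵥ ·) → f x = c) :
    ∑ x, f x = ((Fintype.card F : ℂ) ^ n - Fintype.card F ^ B.rank) * c +
      (Fintype.card F : ℂ) ^ B.rank / Fintype.card F ^ n * ∑ y, f (B *ᵥ y) := by
  classical
  have hq := card_complex_ne_zero (F := F)
  set R := Finset.univ.filter fun x => x ∈ Set.range (B *ᵥ ·) with hR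
  -- The kernel size is the common size of the fibres over the range, hence `q ^ n = N * q ^ rank`.
  set N : ℕ := (Finset.univ.filter fun y : Fin n → F => B *ᵥ y = 0).card with hN
  have hfib : ∀ x ∈ R, (Finset.univ.filter fun y : Fin n → F => B *ᵥ y = x).card = N := by
    intro x hx
    obtain ⟨y, rfl⟩ := (Finset.mem_filter.1 hx).2
    refine Finset.card_bij' (fun v _ => v - y) (fun v _ => v + y) ?_ ?_ ?_ ?_ <;>
      simp +contextual [mulVec_sub, mulVec_add]
  have hRc : (R.card : ℂ) = Fintype.card F ^ B.rank := by
    have h : R.card = Fintype.card (LinearMap.range B.mulVecLin) := by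
      rw [Fintype.card_subtype]
      congr 1
      ext x
      simp [hR]
    rw [h, Module.card_eq_pow_finrank (K := F), ← Matrix.rank]
    push_cast
    rfl
  have hsum : ∀ g : (Fin n → F) → ℂ, ∑ y, g (B *ᵥ y) = N * ∑ x ∈ R, g x := by
    intro g
    rw [← Finset.sum_fiberwise_of_maps_to (s := Finset.univ) (t := R) (g := fun y => B *ᵥ y)
      (by simp [hR]), Finset.mul_sum]
    refine Finset.sum_congr rfl fun x hx => ?_
    rw [← hfib x hx, ← nsmul_eq_mul, ← Finset.sum_const]
    exact Finset.sum_congr rfl fun y hy => by rw [(Finset.mem_filter.1 hy).2]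
  have hN' : (Fintype.card F : ℂ) ^ n = N * Fintype.card F ^ B.rank := by
    have := hsum fun _ => 1
    simpa [hRc] using this
  have hcompl : ∑ x ∈ Finset.univ.filter (fun x => ¬ x ∈ Set.range (B *ᵥ ·)), f x =
      ((Fintype.card F : ℂ) ^ n - Fintype.card F ^ B.rank) * c := by
    rw [Finset.sum_congr rfl fun x hx => hf x (Finset.mem_filter.1 hx).2, Finset.sum_const,
      nsmul_eq_mul, ← hRc]
    congr 1
    rw [eq_sub_iff_add_eq']
    have := Finset.card_filter_add_card_filter_not (s := (Finset.univ : Finset (Fin n → F)))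
      (fun x => x ∈ Set.range (B *ᵥ ·))
    rw [Finset.card_univ, Fintype.card_fun, Fintype.card_fin] at this
    exact_mod_cast this
  rw [← Finset.sum_filter_add_sum_filter_not Finset.univ (fun x => x ∈ Set.range (B *ᵥ ·)),
    hcompl, hsum f, add_comm, hN']
  have hN0 : (N : ℂ) ≠ 0 := by
    intro h
    rw [h, zero_mul] at hN'
    exact pow_ne_zero _ hq hN'
  congr 1
  rw [← hR]
  field_simp

/-- A weight depending on the rank and, affinely, on the character. -/
noncomputable def weight (a b : ℕ → ℂ) (A : Matrix (Fin n) (Fin n) F) : ℂ :=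
  a A.rank + b A.rank * quadChi A

variable (a b : ℕ → ℂ)

/-- The convention `η(0) = 0` puts both cases in one formula: the generic weight plus a correction
supported on `d = quadVal B y`. -/
theorem weight_bordered_mulVec (hF : ringChar F ≠ 2) {B : Matrix (Fin n) (Fin n) F}
    (hB : B.IsSymm) (p : Fin (n + 1)) (d : F) (y : Fin n → F) :
    weight a b (bordered p d (B *ᵥ y) B) = a (B.rank + 1) +
      b (B.rank + 1) * quadChi B * eta (d - quadVal B y) +
      (if d - quadVal B y = 0 then 1 else 0) * (weight a b B - a (B.rank + 1)) := by
  unfold weight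
  split_ifs with h
  · obtain ⟨h1, h2⟩ := bordered_mulVec_of_eq hF hB p h
    rw [h1, h2, h, eta_zero]
    ring
  · obtain ⟨h1, h2⟩ := bordered_mulVec_of_ne hF hB p h
    rw [h1, h2]
    ring

theorem sum_weight_bordered (hF : ringChar F ≠ 2) {B : Matrix (Fin n) (Fin n) F}
    (hB : B.IsSymm) (p : Fin (n + 1)) (d : F) :
    ∑ x, weight a b (bordered p d x B) =
      ((Fintype.card F : ℂ) ^ n - Fintype.card F ^ B.rank) *
        (a (B.rank + 2) + b (B.rank + 2) * (eta (-1 : F) * quadChi B)) +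
      (Fintype.card F : ℂ) ^ B.rank / Fintype.card F ^ n *
        ∑ y, weight a b (bordered p d (B *ᵥ y) B) := by
  refine sum_eq_of_const_off_range B _ _ fun x hx => ?_
  obtain ⟨h1, h2⟩ := bordered_of_notMem_range hF hB p d hx
  rw [weight, h1, h2]

/-- For fixed `y` the values `η(d - quadVal B y)` sum to zero over `d`, and exactly one `d` hits the
correction term. -/
theorem sum_sum_weight_bordered (hF : ringChar F ≠ 2) {B : Matrix (Fin n) (Fin n) F}
    (hB : B.IsSymm) (p : Fin (n + 1)) :
    ∑ d, ∑ x, weight a b (bordered p d x B) =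
      (Fintype.card F : ℂ) * ((Fintype.card F : ℂ) ^ n - Fintype.card F ^ B.rank) *
        (a (B.rank + 2) + b (B.rank + 2) * (eta (-1 : F) * quadChi B)) +
      (Fintype.card F : ℂ) ^ B.rank *
        (weight a b B + ((Fintype.card F : ℂ) - 1) * a (B.rank + 1)) := by
  have hq := card_complex_ne_zero (F := F)
  simp_rw [sum_weight_bordered a b hF hB p]
  rw [Finset.sum_add_distrib, ← Finset.mul_sum, ← Finset.mul_sum, Finset.sum_comm]
  have h : ∀ y, ∑ d, weight a b (bordered p d (B *ᵥ y) B) =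
      weight a b B + ((Fintype.card F : ℂ) - 1) * a (B.rank + 1) := by
    intro y
    simp_rw [weight_bordered_mulVec a b hF hB p]
    rw [Finset.sum_add_distrib, Finset.sum_add_distrib, ← Finset.mul_sum, ← Finset.sum_mul]
    have h1 : ∑ d : F, eta (d - quadVal B y) = 0 :=
      (Equiv.sum_comp (Equiv.subRight (quadVal B y)) eta).trans (sum_eta hF)
    simp [h1, sub_eq_zero]
    ring
  simp only [h, Finset.sum_const, Finset.card_univ, Fintype.card_fun, Fintype.card_fin,
    nsmul_eq_mul]
  push_cast
  field_simp

/-- The contribution from outside the range does not depend on `d` and cancels against the average.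
What remains is the deviation in the number of zeros (even rank) or the sum of `η` of the form (odd
rank). The range factor `q ^ rank / q ^ n` turns `expSum B` into `G ^ rank * χ(B)`, and `χ(B) ^ 2 =
1` simplifies the products. -/
theorem sum_weight_bordered_zero (hF : ringChar F ≠ 2) {B : Matrix (Fin n) (Fin n) F}
    (hB : B.IsSymm) (p : Fin (n + 1)) :
    ∑ x, weight a b (bordered p 0 x B) =
      1 / (Fintype.card F : ℂ) * ∑ d, ∑ x, weight a b (bordered p d x B) +
      if Even B.rank then (1 - 1 / (Fintype.card F : ℂ)) * quadGauss F ^ B.rank *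
          ((a B.rank - a (B.rank + 1)) * quadChi B + b B.rank)
        else b (B.rank + 1) * eta (-1 : F) * ((Fintype.card F : ℂ) - 1) *
          quadGauss F ^ (B.rank - 1) := by
  have hq := card_complex_ne_zero (F := F)
  have hg := quadGauss_ne_zero hF
  have hχ := quadChi_sq hF hB
  rw [sum_sum_weight_bordered a b hF hB, sum_weight_bordered a b hF hB]
  have hneg : ∀ y, eta (0 - quadVal B y) = eta (-1 : F) * eta (quadVal B y) := fun y => by
    rw [← eta_mul]
    congr 1
    ring
  have h : ∑ y, weight a b (bordered p 0 (B *ᵥ y) B) =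
      (Fintype.card F : ℂ) ^ n * a (B.rank + 1) +
        b (B.rank + 1) * quadChi B * (eta (-1 : F) * ∑ y, eta (quadVal B y)) +
        (∑ y : Fin n → F, if quadVal B y = 0 then (1 : ℂ) else 0) *
          (weight a b B - a (B.rank + 1)) := by
    simp_rw [weight_bordered_mulVec a b hF hB p, hneg]
    rw [Finset.sum_add_distrib, Finset.sum_add_distrib, ← Finset.mul_sum, ← Finset.sum_mul,
      ← Finset.mul_sum]
    simp
  have h0 := card_zeros_sub hF hB
  have h1 := sum_eta_quadVal hF hB
  rw [h]
  set Z := ∑ y : Fin n → F, if quadVal B y = 0 then (1 : ℂ) else 0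
  set S := ∑ y : Fin n → F, eta (quadVal B y)
  rw [expSum_eq_quadChi hF] at h0 h1
  rw [← card_mul_normGauss] at h1 hg ⊢
  have hγ := normGauss_ne_zero hF
  unfold weight
  split_ifs at h0 h1 ⊢ with he
  · have hS : S = 0 := (mul_eq_zero.1 h1).resolve_left hg
    rw [hS, eq_add_of_sub_eq h0, mul_pow]
    field_simp
    linear_combination Fintype.card F ^ n * ((Fintype.card F : ℂ) - 1) * b B.rank * normGauss F ^ B.rank *
      Fintype.card F ^ B.rank * hχ
  · rw [sub_eq_zero.1 h0]
    obtain ⟨k, hk⟩ := Nat.not_even_iff_odd.1 he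
    rw [hk] at h1 ⊢
    rw [Nat.add_sub_cancel]
    have hS : S = ((Fintype.card F : ℂ) - 1) * Fintype.card F ^ n / Fintype.card F *
        normGauss F ^ (2 * k) * quadChi B := by
      field_simp
      refine mul_left_cancel₀ hγ ?_
      linear_combination h1
    rw [hS, mul_pow]
    field_simp
    linear_combination Fintype.card F ^ (2 * k + 1) * (eta (-1 : F) * b (2 * k + 1 + 1) *
      ((Fintype.card F : ℂ) - 1) * normGauss F ^ (2 * k)) * hχ

end FiberSums

/-! ### Summation over symmetric matrices with vanishing initial diagonal. -/

section MatrixSums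

variable (F : Type*) [Field F] [Fintype F] [DecidableEq F]

open Classical in
/-- The symmetric matrices whose first `k` diagonal entries vanish. -/
noncomputable def symSet (n k : ℕ) : Finset (Matrix (Fin n) (Fin n) F) :=
  Finset.univ.filter fun A => A.IsSymm ∧ ∀ i : Fin n, (i : ℕ) < k → A i i = 0

/-- The sum of a weight over the symmetric matrices whose first `k` diagonal entries vanish. -/
noncomputable def weightSum (a b : ℕ → ℂ) (n k : ℕ) : ℂ := ∑ A ∈ symSet F n k, weight a b A

variable {F}

theorem mem_symSet {n k : ℕ} {A : Matrix (Fin n) (Fin n) F} :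
    A ∈ symSet F n k ↔ A.IsSymm ∧ ∀ i : Fin n, (i : ℕ) < k → A i i = 0 := by
  simp [symSet]

theorem val_succAbove_lt_iff {n : ℕ} {p : Fin (n + 1)} {j : Fin n} :
    (p.succAbove j : ℕ) < p ↔ (j : ℕ) < p := by
  rw [Fin.succAbove]
  split_ifs with h
  · simp
  · have : (p : ℕ) ≤ j := by simpa [Fin.lt_def] using h
    simp
    omega

theorem val_succAbove_lt_succ_iff {n : ℕ} {p : Fin (n + 1)} {j : Fin n} :
    (p.succAbove j : ℕ) < p + 1 ↔ (j : ℕ) < p := by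
  rw [Nat.lt_succ_iff_lt_or_eq, val_succAbove_lt_iff, or_iff_left]
  exact fun h => Fin.succAbove_ne p j (Fin.ext h)

theorem bordered_mem_symSet {n : ℕ} {p : Fin (n + 1)} {d : F} {x : Fin n → F}
    {B : Matrix (Fin n) (Fin n) F} (hB : B ∈ symSet F n p) :
    bordered p d x B ∈ symSet F (n + 1) p := by
  rw [mem_symSet] at hB ⊢
  refine ⟨isSymm_bordered p d x hB.1, fun i hi => ?_⟩
  induction i using Fin.succAboveCases p with
  | x => simp at hi
  | p j => simpa using hB.2 j (val_succAbove_lt_iff.1 hi)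

theorem bordered_zero_mem_symSet {n : ℕ} {p : Fin (n + 1)} {x : Fin n → F}
    {B : Matrix (Fin n) (Fin n) F} (hB : B ∈ symSet F n p) :
    bordered p 0 x B ∈ symSet F (n + 1) (p + 1) := by
  rw [mem_symSet] at hB ⊢
  refine ⟨isSymm_bordered p 0 x hB.1, fun i hi => ?_⟩
  induction i using Fin.succAboveCases p with
  | x => simp
  | p j => simpa using hB.2 j (val_succAbove_lt_succ_iff.1 hi)

theorem submatrix_mem_symSet {n : ℕ} {p : Fin (n + 1)} {A : Matrix (Fin (n + 1)) (Fin (n + 1)) F}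
    (hA : A ∈ symSet F (n + 1) p) : A.submatrix p.succAbove p.succAbove ∈ symSet F n p := by
  rw [mem_symSet] at hA ⊢
  exact ⟨hA.1.submatrix _, fun i hi => hA.2 _ (val_succAbove_lt_iff.2 hi)⟩

theorem symSet_succ_subset (n k : ℕ) : symSet F n (k + 1) ⊆ symSet F n k := fun A hA => by
  rw [mem_symSet] at hA ⊢
  exact ⟨hA.1, fun i hi => hA.2 i (by omega)⟩

omit [Field F] [Fintype F] [DecidableEq F] in
theorem submatrix_bordered {n : ℕ} (p : Fin (n + 1)) (d : F) (x : Fin n → F)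
    (B : Matrix (Fin n) (Fin n) F) :
    (bordered p d x B).submatrix p.succAbove p.succAbove = B := by
  ext i j
  simp

/-- The removed row and column have index `k`, the first one with unconstrained diagonal entry, so
the other constraints pass unchanged to the minor. -/
theorem sum_symSet_succ {n k : ℕ} (hk : k ≤ n) (f : Matrix (Fin (n + 1)) (Fin (n + 1)) F → ℂ) :
    ∑ A ∈ symSet F (n + 1) k, f A =
      ∑ B ∈ symSet F n k, ∑ d, ∑ x, f (bordered (⟨k, by omega⟩ : Fin (n + 1)) d x B) := by
  set p : Fin (n + 1) := ⟨k, by omega⟩ with hp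
  have hkp : k = p := rfl
  have hprod : ∑ B ∈ symSet F n k, ∑ d, ∑ x, f (bordered p d x B) =
      ∑ t ∈ symSet F n k ×ˢ (Finset.univ : Finset (F × (Fin n → F))),
        f (bordered p t.2.1 t.2.2 t.1) := by
    rw [Finset.sum_product]
    exact Finset.sum_congr rfl fun B _ => (Fintype.sum_prod_type
      fun y : F × (Fin n → F) => f (bordered p y.1 y.2 B)).symm
  rw [hprod, hkp]
  refine Finset.sum_bij'
    (fun A _ => (A.submatrix p.succAbove p.succAbove, A p p, fun j => A p (p.succAbove j)))
    (fun t _ => bordered p t.2.1 t.2.2 t.1) ?_ ?_ ?_ ?_ ?_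
  · intro A hA
    simp [submatrix_mem_symSet hA]
  · intro t ht
    simp only [Finset.mem_product] at ht
    exact bordered_mem_symSet ht.1
  · intro A hA
    exact (eq_bordered p (mem_symSet.1 hA).1).symm
  · rintro ⟨B, d, x⟩ _
    simp [submatrix_bordered]
  · intro A hA
    rw [← eq_bordered p (mem_symSet.1 hA).1]

theorem sum_symSet_succ_succ {n k : ℕ} (hk : k ≤ n)
    (f : Matrix (Fin (n + 1)) (Fin (n + 1)) F → ℂ) :
    ∑ A ∈ symSet F (n + 1) (k + 1), f A =
      ∑ B ∈ symSet F n k, ∑ x, f (bordered (⟨k, by omega⟩ : Fin (n + 1)) 0 x B) := by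
  set p : Fin (n + 1) := ⟨k, by omega⟩ with hp
  have hkp : k = p := rfl
  rw [← Finset.sum_product', hkp]
  have h0 : ∀ A ∈ symSet F (n + 1) (p + 1),
      A = bordered p 0 (fun j => A p (p.succAbove j)) (A.submatrix p.succAbove p.succAbove) := by
    intro A hA
    have h := (mem_symSet.1 hA).2 p (Nat.lt_succ_self _)
    conv_lhs => rw [eq_bordered p (mem_symSet.1 hA).1, h]
  refine Finset.sum_bij'
    (fun A _ => (A.submatrix p.succAbove p.succAbove, fun j => A p (p.succAbove j)))
    (fun t _ => bordered p 0 t.2 t.1) ?_ ?_ ?_ ?_ ?_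
  · intro A hA
    simp [submatrix_mem_symSet (symSet_succ_subset _ _ hA)]
  · intro t ht
    simp only [Finset.mem_product] at ht
    exact bordered_zero_mem_symSet ht.1
  · intro A hA
    exact (h0 A hA).symm
  · rintro ⟨B, x⟩ _
    simp [submatrix_bordered]
  · intro A hA
    rw [← h0 A hA]

variable (a b : ℕ → ℂ)

theorem weightSum_succ (hF : ringChar F ≠ 2) {n k : ℕ} (hk : k ≤ n) :
    weightSum F a b (n + 1) k = ∑ B ∈ symSet F n k,
      ((Fintype.card F : ℂ) * ((Fintype.card F : ℂ) ^ n - Fintype.card F ^ B.rank) *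
        (a (B.rank + 2) + b (B.rank + 2) * (eta (-1 : F) * quadChi B)) +
      (Fintype.card F : ℂ) ^ B.rank *
        (weight a b B + ((Fintype.card F : ℂ) - 1) * a (B.rank + 1))) := by
  rw [weightSum, sum_symSet_succ hk]
  exact Finset.sum_congr rfl fun B hB => sum_sum_weight_bordered a b hF (mem_symSet.1 hB).1 _

theorem weightSum_succ_succ (hF : ringChar F ≠ 2) {n k : ℕ} (hk : k ≤ n) :
    weightSum F a b (n + 1) (k + 1) = 1 / (Fintype.card F : ℂ) * weightSum F a b (n + 1) k +
      ∑ B ∈ symSet F n k, if Even B.rank then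
          (1 - 1 / (Fintype.card F : ℂ)) * quadGauss F ^ B.rank *
            ((a B.rank - a (B.rank + 1)) * quadChi B + b B.rank)
        else b (B.rank + 1) * eta (-1 : F) * ((Fintype.card F : ℂ) - 1) *
          quadGauss F ^ (B.rank - 1) := by
  rw [weightSum, weightSum, sum_symSet_succ hk, sum_symSet_succ_succ hk, Finset.mul_sum,
    ← Finset.sum_add_distrib]
  exact Finset.sum_congr rfl fun B hB => sum_weight_bordered_zero a b hF (mem_symSet.1 hB).1 _

end MatrixSums

/-! ### Recursions for the number of matrices and for the sum of their characters. -/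

section Recursions

variable (F : Type*) [Field F] [Fintype F] [DecidableEq F]

/-- The number of symmetric matrices of rank `r` whose first `k` diagonal entries vanish. -/
noncomputable def rankSum (n k r : ℕ) : ℂ := weightSum F (fun s => if s = r then 1 else 0) 0 n k

/-- The sum of the characters of the symmetric matrices of rank `r` whose first `k` diagonal
entries vanish. -/
noncomputable def charSum (n k r : ℕ) : ℂ := weightSum F 0 (fun s => if s = r then 1 else 0) n k

variable {F}

theorem rankSum_eq (n k r : ℕ) :
    rankSum F n k r = ∑ A ∈ symSet F n k, if A.rank = r then 1 else 0 := by
  simp [rankSum, weightSum, weight]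

theorem charSum_eq (n k r : ℕ) :
    charSum F n k r = ∑ A ∈ symSet F n k, if A.rank = r then quadChi A else 0 := by
  simp [charSum, weightSum, weight]

theorem rankSum_two_mul (hF : ringChar F ≠ 2) {n k : ℕ} (hk : k ≤ n) {m : ℕ} :
    rankSum F (n + 1) (k + 1) (2 * m) = 1 / (Fintype.card F : ℂ) * rankSum F (n + 1) k (2 * m) +
      (1 - 1 / (Fintype.card F : ℂ)) * quadGauss F ^ (2 * m) * charSum F n k (2 * m) := by
  rw [rankSum, weightSum_succ_succ _ _ hF hk, charSum_eq, Finset.mul_sum]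
  congr 1
  refine Finset.sum_congr rfl fun B _ => ?_
  split_ifs with he h1 h2 h3 <;> first | (exfalso; grind) | simp [*]

theorem charSum_two_mul_add_two (hF : ringChar F ≠ 2) {n k : ℕ} (hk : k ≤ n) (m : ℕ) :
    charSum F (n + 1) (k + 1) (2 * m + 2) =
      1 / (Fintype.card F : ℂ) * charSum F (n + 1) k (2 * m + 2) +
      ((1 - 1 / (Fintype.card F : ℂ)) * quadGauss F ^ (2 * m + 2) * rankSum F n k (2 * m + 2) +
        eta (-1 : F) * ((Fintype.card F : ℂ) - 1) * quadGauss F ^ (2 * m) *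
          rankSum F n k (2 * m + 1)) := by
  rw [charSum, weightSum_succ_succ _ _ hF hk, rankSum_eq, rankSum_eq, Finset.mul_sum,
    Finset.mul_sum, ← Finset.sum_add_distrib]
  congr 1
  refine Finset.sum_congr rfl fun B _ => ?_
  split_ifs with he h1 h2 h3 <;> first | (exfalso; grind) | simp [*]

/-- Only minors of rank `2 * m` contribute to the correction, through `-a (rank + 1)`; hence the
minus sign. -/
theorem rankSum_two_mul_add_one (hF : ringChar F ≠ 2) {n k : ℕ} (hk : k ≤ n) (m : ℕ) :
    rankSum F (n + 1) (k + 1) (2 * m + 1) =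
      1 / (Fintype.card F : ℂ) * rankSum F (n + 1) k (2 * m + 1) -
      (1 - 1 / (Fintype.card F : ℂ)) * quadGauss F ^ (2 * m) * charSum F n k (2 * m) := by
  rw [rankSum, weightSum_succ_succ _ _ hF hk, charSum_eq, Finset.mul_sum, sub_eq_add_neg (_ * _),
    ← Finset.sum_neg_distrib]
  congr 1
  refine Finset.sum_congr rfl fun B _ => ?_
  split_ifs with he h1 h2 h3 <;> first | (exfalso; grind) | simp [*]

/-- Multiplication by a non-square permutes these matrices, keeping the rank and the diagonal zeros,
and flips the character in odd rank. -/
theorem charSum_odd (hF : ringChar F ≠ 2) (n k : ℕ) {r : ℕ} (hr : Odd r) :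
    charSum F n k r = 0 := by
  obtain ⟨z, hz⟩ := quadraticChar_exists_neg_one hF
  have hz1 : eta z = -1 := by simp [eta, hz]
  have hz0 : z ≠ 0 := by
    rintro rfl
    simp at hz
  have h : charSum F n k r = -charSum F n k r := by
    rw [charSum_eq]
    conv_rhs => rw [← Finset.sum_neg_distrib]
    refine Finset.sum_bij' (fun A _ => z⁻¹ • A) (fun A _ => z • A) ?_ ?_ ?_ ?_ ?_
    · intro A hA
      rw [mem_symSet] at hA ⊢
      exact ⟨hA.1.smul _, fun i hi => by simp [hA.2 i hi]⟩
    · intro A hA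
      rw [mem_symSet] at hA ⊢
      exact ⟨hA.1.smul _, fun i hi => by simp [hA.2 i hi]⟩
    · intro A _
      simp [smul_smul, hz0]
    · intro A _
      simp [smul_smul, hz0]
    · intro A hA
      have hA' : (z⁻¹ • A).IsSymm := (mem_symSet.1 hA).1.smul _
      obtain ⟨h1, h2⟩ := rank_and_quadChi_smul hF hA' hz0
      rw [smul_smul, mul_inv_cancel₀ hz0, one_smul] at h1 h2
      rw [h1, h2, hz1]
      split_ifs with h3
      · rw [h3, hr.neg_one_pow, neg_one_mul]
      · simp
  linear_combination h / 2

omit [Fintype F] [DecidableEq F] in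
theorem eq_zero_of_rank_eq_zero {n : ℕ} {A : Matrix (Fin n) (Fin n) F} (h : A.rank = 0) :
    A = 0 := by
  rw [Matrix.rank, Submodule.finrank_eq_zero, LinearMap.range_eq_bot] at h
  ext i j
  simpa using congrFun (LinearMap.congr_fun h (Pi.single j 1)) i

theorem rankSum_rank_zero (n k : ℕ) : rankSum F n k 0 = 1 := by
  rw [rankSum_eq, Finset.sum_eq_single 0]
  · simp
  · intro A _ hA
    rw [if_neg fun h => hA (eq_zero_of_rank_eq_zero h)]
  · simp [mem_symSet]

theorem charSum_rank_zero (hF : ringChar F ≠ 2) (n k : ℕ) : charSum F n k 0 = 1 := by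
  rw [charSum_eq, Finset.sum_eq_single 0]
  · simp [quadChi_zero hF]
  · intro A _ hA
    rw [if_neg fun h => hA (eq_zero_of_rank_eq_zero h)]
  · simp [mem_symSet]

theorem rankSum_size_zero (k : ℕ) {r : ℕ} (hr : r ≠ 0) : rankSum F 0 k r = 0 := by
  rw [rankSum_eq]
  refine Finset.sum_eq_zero fun A _ => if_neg ?_
  have : A.rank ≤ 0 := by simpa using A.rank_le_width
  omega

theorem charSum_size_zero (k : ℕ) {r : ℕ} (hr : r ≠ 0) : charSum F 0 k r = 0 := by
  rw [charSum_eq]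
  refine Finset.sum_eq_zero fun A _ => if_neg ?_
  have : A.rank ≤ 0 := by simpa using A.rank_le_width
  omega

theorem rankSum_succ_one (hF : ringChar F ≠ 2) (n : ℕ) :
    rankSum F (n + 1) 0 1 =
      Fintype.card F * rankSum F n 0 1 + ((Fintype.card F : ℂ) - 1) * rankSum F n 0 0 := by
  rw [rankSum, weightSum_succ _ _ hF (Nat.zero_le n), rankSum_eq, rankSum_eq, Finset.mul_sum,
    Finset.mul_sum, ← Finset.sum_add_distrib]
  refine Finset.sum_congr rfl fun B _ => ?_
  unfold weight
  split_ifs with h1 h2 h3 <;> first | (exfalso; omega) | simp [*]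

theorem rankSum_succ_add_two (hF : ringChar F ≠ 2) (n r : ℕ) :
    rankSum F (n + 1) 0 (r + 2) =
      Fintype.card F * ((Fintype.card F : ℂ) ^ n - Fintype.card F ^ r) * rankSum F n 0 r +
      Fintype.card F ^ (r + 2) * rankSum F n 0 (r + 2) +
      Fintype.card F ^ (r + 1) * ((Fintype.card F : ℂ) - 1) * rankSum F n 0 (r + 1) := by
  rw [rankSum, weightSum_succ _ _ hF (Nat.zero_le n), rankSum_eq, rankSum_eq, rankSum_eq,
    Finset.mul_sum, Finset.mul_sum, Finset.mul_sum, ← Finset.sum_add_distrib,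
    ← Finset.sum_add_distrib]
  refine Finset.sum_congr rfl fun B _ => ?_
  unfold weight
  split_ifs with h1 h2 h3 <;> first | (exfalso; omega) | simp [*]

theorem charSum_succ_add_two (hF : ringChar F ≠ 2) (n r : ℕ) :
    charSum F (n + 1) 0 (r + 2) =
      Fintype.card F * ((Fintype.card F : ℂ) ^ n - Fintype.card F ^ r) * eta (-1 : F) *
        charSum F n 0 r + Fintype.card F ^ (r + 2) * charSum F n 0 (r + 2) := by
  rw [charSum, weightSum_succ _ _ hF (Nat.zero_le n), charSum_eq, charSum_eq,
    Finset.mul_sum, Finset.mul_sum, ← Finset.sum_add_distrib]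
  refine Finset.sum_congr rfl fun B _ => ?_
  unfold weight
  split_ifs with h1 h2 h3 <;> first | (exfalso; omega) | simp [*, mul_assoc]

/-- This ratio of consecutive counts stands in for their product formulas: it propagates by itself
under the three-term recursion, from ranks `2 * s` and `2 * s + 2` at size `n`. -/
theorem card_pow_mul_rankSum (hF : ringChar F ≠ 2) (n s : ℕ) :
    (Fintype.card F : ℂ) ^ (2 * s) * rankSum F n 0 (2 * s + 1) =
      ((Fintype.card F : ℂ) ^ n - Fintype.card F ^ (2 * s)) * rankSum F n 0 (2 * s) := by
  induction n generalizing s with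
  | zero =>
    rcases s with - | s
    · simp [rankSum_size_zero]
    · rw [rankSum_size_zero _ (by omega), rankSum_size_zero _ (by omega), mul_zero, mul_zero]
  | succ n ih =>
    rcases s with - | s
    · have h := ih 0
      simp only [Nat.mul_zero, Nat.zero_add, pow_zero, rankSum_rank_zero, one_mul, mul_one] at h ⊢
      rw [rankSum_succ_one hF, h, rankSum_rank_zero]
      ring
    · have h0 := ih s
      have h1 := ih (s + 1)
      rw [show 2 * (s + 1) + 1 = 2 * s + 1 + 2 by ring, show 2 * (s + 1) = 2 * s + 2 by ring] at h1 ⊢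
      rw [rankSum_succ_add_two hF, rankSum_succ_add_two hF,
        show 2 * s + 1 + 1 = 2 * s + 2 by ring]
      linear_combination (Fintype.card F : ℂ) ^ 3 * Fintype.card F ^ (2 * s) * h1 +
        (Fintype.card F : ℂ) ^ 2 * (Fintype.card F ^ n - Fintype.card F * Fintype.card F ^ (2 * s))
          * h0

/-- The recursion for `charSum` lacks the odd-rank term of the one for `rankSum`. Rewriting that
term by `card_pow_mul_rankSum` merges it with the rank `2 * s` term, and the two recursions become
proportional. -/
theorem card_pow_mul_charSum (hF : ringChar F ≠ 2) (n s : ℕ) :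
    (Fintype.card F : ℂ) ^ s * charSum F n 0 (2 * s) =
      eta (-1 : F) ^ s * rankSum F n 0 (2 * s) := by
  induction n generalizing s with
  | zero =>
    rcases s with - | s
    · simp [rankSum_rank_zero, charSum_rank_zero hF]
    · rw [rankSum_size_zero _ (by omega), charSum_size_zero _ (by omega), mul_zero, mul_zero]
  | succ n ih =>
    rcases s with - | s
    · simp [rankSum_rank_zero, charSum_rank_zero hF]
    · have d0 := ih s
      have d1 := ih (s + 1)
      have h0 := card_pow_mul_rankSum hF n s
      rw [show 2 * (s + 1) = 2 * s + 2 by ring] at d1 ⊢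
      rw [charSum_succ_add_two hF, rankSum_succ_add_two hF]
      linear_combination (Fintype.card F : ℂ) ^ 2 *
        (Fintype.card F ^ n - Fintype.card F ^ (2 * s)) * eta (-1 : F) * d0 +
        (Fintype.card F : ℂ) ^ 2 * Fintype.card F ^ (2 * s) * d1 -
        eta (-1 : F) ^ (s + 1) * Fintype.card F * ((Fintype.card F : ℂ) - 1) * h0

theorem rankSum_one (hF : ringChar F ≠ 2) {n k : ℕ} (hk : k ≤ n) :
    rankSum F n k 1 = (Fintype.card F : ℂ) ^ (n - k) - 1 := by
  induction k with
  | zero => simpa [rankSum_rank_zero] using card_pow_mul_rankSum hF n 0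
  | succ k ih =>
    obtain ⟨n, rfl⟩ : ∃ m, n = m + 1 := ⟨n - 1, by omega⟩
    have h := rankSum_two_mul_add_one hF (n := n) (k := k) (by omega) 0
    simp only [Nat.mul_zero, Nat.zero_add, pow_zero, charSum_rank_zero hF, mul_one] at h
    rw [h, ih (by omega), show n + 1 - k = n - k + 1 by omega, Nat.add_sub_add_right]
    have hq := card_complex_ne_zero (F := F)
    field_simp
    ring

end Recursions

/-! ### From sums back to cardinalities. -/

section Counts

variable {F : Type*} [Field F] [Fintype F] [DecidableEq F]

theorem symZero_eq_rankSum (n k r : ℕ) : (symZero F n k r : ℂ) = rankSum F n k r := by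
  classical
  rw [rankSum_eq, symZero, Nat.card_eq_fintype_card, Fintype.card_subtype, Finset.sum_boole,
    symSet, Finset.filter_filter]
  congr 3
  ext A
  tauto

omit [Fintype F] [DecidableEq F] in
theorem sym_eq_symZero (n r : ℕ) : sym F n r = symZero F n 0 r := by
  simp [sym, symZero]

/-- For signs, the indicator of `χ = ε` is `(1 + ε * χ) / 2`. -/
theorem symZeroChar_eq (hF : ringChar F ≠ 2) (ε : ℤˣ) (n k r : ℕ) :
    (symZeroChar F ε n k r : ℂ) =
      (rankSum F n k r + ((ε : ℤ) : ℂ) * charSum F n k r) / 2 := by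
  classical
  have h1 : (symZeroChar F ε n k r : ℂ) =
      ∑ A ∈ symSet F n k, if A.rank = r ∧ HasCharacter A ε then 1 else 0 := by
    rw [symZeroChar, Nat.card_eq_fintype_card, Fintype.card_subtype, Finset.sum_boole,
      symSet, Finset.filter_filter]
    congr 3
    ext A
    tauto
  rw [h1, rankSum_eq, charSum_eq, Finset.mul_sum, ← Finset.sum_add_distrib, Finset.sum_div]
  refine Finset.sum_congr rfl fun A hA => ?_
  have hs := (mem_symSet.1 hA).1
  rw [hasCharacter_iff hF hs]
  by_cases hr : A.rank = r
  · rcases mul_self_eq_one_iff.1 ((sq _).symm.trans (quadChi_sq hF hs)) with h | h <;>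
      rcases Int.units_eq_one_or ε with rfl | rfl <;> simp [hr, h] <;> norm_num
  · simp [hr]

theorem neg_one_pow_tExp (m : ℕ) : (-1 : ℂ) ^ tExp F m = eta (-1 : F) ^ m := by
  have h : eta (-1 : F) ^ m = eta ((-1 : F) ^ m) := by
    induction m with
    | zero => simp
    | succ m ih => rw [pow_succ, pow_succ, eta_mul, ih]
  have h0 : (-1 : F) ^ m ≠ 0 := pow_ne_zero _ (neg_ne_zero.2 one_ne_zero)
  rw [h, tExp]
  split_ifs with hs
  · simp [eta_of_isSquare h0 hs]
  · simp [eta_of_not_isSquare hs]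

omit [DecidableEq F] in
theorem ringChar_ne_two_of_odd_card (h : Odd (Fintype.card F)) : ringChar F ≠ 2 := fun h2 => by
  have := FiniteField.even_card_of_char_two h2
  rw [Nat.odd_iff] at h
  omega

theorem quadGauss_pow_two_mul (hF : ringChar F ≠ 2) (m : ℕ) :
    quadGauss F ^ (2 * m) = eta (-1 : F) ^ m * Fintype.card F ^ m := by
  rw [pow_mul, quadGauss_sq hF, mul_pow]

end Counts

end SymmetricMatrixCounts

/-! ### Assembly of the recursions and initial values. -/

theorem mainTheorem10 (F : Type*) [Field F] [Fintype F] [DecidableEq F]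
    (q : ℕ) (hcard : Fintype.card F = q) (hq : Odd q) :
    (∀ (n k r : ℕ) (ε : ℤˣ), k ≤ n → Odd r →
      (symZeroChar F ε (n + 1) (k + 1) (r + 1) : ℚ) =
        1 / (q : ℚ) * symZeroChar F ε (n + 1) k (r + 1) +
          (-1 : ℚ) ^ tExp F ((r + 1) / 2) * ((ε : ℤ) : ℚ) *
            (1 / 2 * (symZero F n k r : ℚ) + symZeroChar F ε n k (r + 1)) *
            ((q : ℚ) ^ ((r + 1) / 2) - (q : ℚ) ^ ((r - 1) / 2))) ∧
    (∀ (n k r : ℕ) (ε : ℤˣ), k ≤ n → Even r → 0 < r →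
      (symZeroChar F ε (n + 1) (k + 1) (r + 1) : ℚ) =
        1 / (q : ℚ) * symZeroChar F ε (n + 1) k (r + 1) -
          (-1 : ℚ) ^ tExp F (r / 2) / 2 *
            ((symZeroChar F 1 n k r : ℚ) - symZeroChar F (-1) n k r) *
            ((q : ℚ) ^ (r / 2) - (q : ℚ) ^ (r / 2 - 1))) ∧
    (∀ (n k : ℕ) (ε : ℤˣ), k ≤ n →
      (symZeroChar F ε (n + 1) (k + 1) 1 : ℚ) = 1 / 2 * (symZero F (n + 1) (k + 1) 1 : ℚ) ∧
      1 / 2 * (symZero F (n + 1) (k + 1) 1 : ℚ) =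
        ((q : ℚ) - 1) / 2 * ∑ i ∈ Finset.range (n - k), (q : ℚ) ^ i ∧
      ((q : ℚ) - 1) / 2 * ∑ i ∈ Finset.range (n - k), (q : ℚ) ^ i =
        ((q : ℚ) ^ (n - k) - 1) / 2) ∧
    (∀ n s : ℕ,
      (symZeroChar F 1 n 0 (2 * s + 1) : ℚ) = 1 / 2 * (sym F n (2 * s + 1) : ℚ)) ∧
    (∀ n s : ℕ,
      (symZeroChar F 1 n 0 (2 * s) : ℚ) =
        1 / 2 * (((q : ℚ) ^ s + ((quadraticChar F (-1) : ℤ) : ℚ) ^ s) / (q : ℚ) ^ s) *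
          (sym F n (2 * s) : ℚ)) := by
  have hF := ringChar_ne_two_of_odd_card (F := F) (hcard ▸ hq)
  have hq0 : (q : ℂ) ≠ 0 := hcard ▸ card_complex_ne_zero (F := F)
  -- The Gauss sums live in `ℂ`, so the rational identities are checked there.
  have hcast : ∀ {x y : ℚ}, (x : ℂ) = y → x = y := fun h => Rat.cast_injective h
  have hε : ∀ ε : ℤˣ, ((ε : ℤ) : ℂ) ^ 2 = 1 := by
    intro ε
    rcases Int.units_eq_one_or ε with rfl | rfl <;> simp
  refine ⟨?_, ?_, ?_, ?_, ?_⟩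
  · rintro n k _ ε hk ⟨m, rfl⟩
    apply hcast
    rw [show (2 * m + 1 + 1) / 2 = m + 1 by omega, show (2 * m + 1 - 1) / 2 = m by omega]
    push_cast
    rw [symZeroChar_eq hF, symZeroChar_eq hF, symZeroChar_eq hF, symZero_eq_rankSum,
      neg_one_pow_tExp, charSum_two_mul_add_two hF hk, show 2 * m + 1 + 1 = 2 * (m + 1) by ring,
      rankSum_two_mul hF hk, quadGauss_pow_two_mul hF,
      quadGauss_pow_two_mul hF, hcard]
    field_simp
    -- The factor `ε` of the correction meets the `ε * charSum` inside the count by character; `ε ^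
    -- 2 = 1` reduces this to the `charSum` term of `rankSum_two_mul`.
    linear_combination (-(eta (-1 : F) ^ (m + 1) * (q ^ (m + 2) - q ^ (m + 1)) *
      charSum F n k (2 * (m + 1)))) * hε ε
  · rintro n k r ε hk hr hr0
    obtain ⟨m, rfl⟩ : ∃ m, r = 2 * (m + 1) := by
      obtain ⟨m, rfl⟩ := hr
      exact ⟨m - 1, by omega⟩
    apply hcast
    rw [show 2 * (m + 1) / 2 = m + 1 by omega, Nat.add_sub_cancel]
    push_cast
    rw [symZeroChar_eq hF, symZeroChar_eq hF, symZeroChar_eq hF, symZeroChar_eq hF,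
      neg_one_pow_tExp, charSum_odd hF _ _ ⟨m + 1, rfl⟩, charSum_odd hF _ _ ⟨m + 1, rfl⟩,
      rankSum_two_mul_add_one hF hk, quadGauss_pow_two_mul hF, hcard]
    push_cast
    field_simp
    ring
  · intro n k ε hk
    have hgeom : ((q : ℚ) - 1) / 2 * ∑ i ∈ Finset.range (n - k), (q : ℚ) ^ i =
        ((q : ℚ) ^ (n - k) - 1) / 2 := by
      rw [← mul_geom_sum]
      ring
    refine ⟨?_, ?_, hgeom⟩
    · apply hcast
      push_cast
      rw [symZeroChar_eq hF, symZero_eq_rankSum, charSum_odd hF _ _ odd_one]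
      ring
    · rw [hgeom]
      apply hcast
      push_cast
      rw [symZero_eq_rankSum, rankSum_one hF (by omega), Nat.add_sub_add_right, hcard]
      ring
  · intro n s
    apply hcast
    push_cast
    rw [symZeroChar_eq hF, sym_eq_symZero, symZero_eq_rankSum, charSum_odd hF _ _ ⟨s, rfl⟩]
    ring
  · intro n s
    apply hcast
    push_cast
    have h := card_pow_mul_charSum hF n s
    rw [hcard] at h
    rw [symZeroChar_eq hF, sym_eq_symZero, symZero_eq_rankSum]
    -- The cast of `quadraticChar F (-1)` is `eta (-1)` by definition.
    change _ = 1 / 2 * (((q : ℂ) ^ s + eta (-1 : F) ^ s) / q ^ s) * _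
    push_cast
    field_simp
    linear_combination h
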